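/- **Setting.** For every $x\in\mathbb Z$ let $\mathfrak A_x$ be a unital $C^*$-algebra and $\xi_x:\mathfrak A_x\to\mathbb C^{2\times 2}$ a $*$-isomorphism. For a nonempty finite set $\Lambda\subset\mathbb Z$ let $\mathfrak A_\Lambda=\bigotimes_{x\in\Lambda}\mathfrak A_x$ be the algebraic tensor product, with factorwise multiplication and involution and with its unique $C^*$-norm (the spectral norm, under the identification $\bigotimes_x\xi_x$ with the matrices of size $2^{|\Lambda|}$). Let $\mathfrak A$ be the inductive limit $C^*$-algebra (infinite tensor product) of the $\mathfrak A_\Lambda$ with respect to the unital embeddings $A\mapsto A\otimes 1_{\Lambda'\setminus\Lambda}$, $\Lambda\subseteq\Lambda'$. Let $\sigma_0=1$, let $\sigma_1,\sigma_2,\sigma_3$ be the Pauli matrices, and let $\sigma_\kappa^{(x)}\in\mathfrak A$ be the image of $\xi_x^{-1}(\sigma_\kappa)\in\mathfrak A_x$. Set $\sigma_-^{(x)}=\frac12(\sigma_1^{(x)}-\mathrm i\sigma_2^{(x)})$, and $S_x=\prod_{1\le y\le x-1}\sigma_3^{(y)}$ if $x\ge 1$ (so $S_1=1$), $S_x=\prod_{x\le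 y\le 0}\sigma_3^{(y)}$ if $x\le 0$. With $\varepsilon_0=\varepsilon_3=1$ and $\varepsilon_1=\varepsilon_2=-1$, let $\Theta,\Theta'$ be the $*$-automorphisms of $\mathfrak A$ with $\Theta(\sigma_\kappa^{(x)})=\varepsilon_\kappa\sigma_\kappa^{(x)}$ for all $x$, and $\Theta'(\sigma_\kappa^{(x)})=\sigma_\kappa^{(x)}$ for $x\ge 1$, $\Theta'(\sigma_\kappa^{(x)})=\varepsilon_\kappa\sigma_\kappa^{(x)}$ for $x\le 0$. In the $C^*$-algebra $\mathfrak A^{2\times 2}$ of $2\times2$ matrices over $\mathfrak A$ consider the unital $C^*$-subalgebra $$\widehat{\mathfrak A}=\left\{\begin{bmatrix}A&B\\ \Theta'(B)&\Theta'(A)\end{bmatrix}\,\middle|\,A,B\in\mathfrak A\right\},\qquad \psi(A)=\begin{bmatrix}A&0\\0&\Theta'(A)\end{bmatrix}\ (A\in\mathfrak A),\qquad T=\begin{bmatrix}0&1\\1&0\end{bmatrix}\in\widehat{\mathfrak A},$$ the spin subalgebra $\widehat{\mathfrak A}_0=\psi(\mathfrak A)$, the annihilation operators $a_x=T\psi(S_x\sigma_-^{(x)})$,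 and the CAR subalgebra $\widehat{\mathfrak A}_1$, the intersection of all $C^*$-subalgebras of $\widehat{\mathfrak A}$ that contain $a_x$ for all $x\in\mathbb Z$. For $\mathcal C\subseteq\widehat{\mathfrak A}$ put $\mathcal CT=\{AT\mid A\in\mathcal C\}$. **Proposition (Decomposition).** (a) There is a unique $*$-automorphism $\widehat\Theta$ of $\widehat{\mathfrak A}$ with $\widehat\Theta\circ\psi=\psi\circ\Theta$ and $\widehat\Theta(T)=T$. (b) We have $\widehat\Theta(\widehat{\mathfrak A}_0)\subseteq\widehat{\mathfrak A}_0$ and $\widehat\Theta(\widehat{\mathfrak A}_1)\subseteq\widehat{\mathfrak A}_1$. Let $\widehat{\mathfrak A}_\pm=\{A\in\widehat{\mathfrak A}\mid\widehat\Theta(A)=\pm A\}$ and $\widehat{\mathfrak A}_{i,\pm}=\{A\in\widehat{\mathfrak A}_i\mid\widehat\Theta(A)=\pm A\}$ for $i\in\{0,1\}$. The even parts $\widehat{\mathfrak A}_+$, $\widehat{\mathfrak A}_{0,+}$, $\widehat{\mathfrak A}_{1,+}$ are unital $C^*$-subalgebras of $\widehat{\mathfrak A}$. The odd parts $\widehat{\mathfrak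 A}_-$, $\widehat{\mathfrak A}_{0,-}$, $\widehat{\mathfrak A}_{1,-}$ are norm closed vector subspaces of $\widehat{\mathfrak A}$ that are invariant under the involution. (c) As internal direct sums of vector subspaces, $\widehat{\mathfrak A}=\widehat{\mathfrak A}_+\oplus\widehat{\mathfrak A}_-$, $\widehat{\mathfrak A}_0=\widehat{\mathfrak A}_{0,+}\oplus\widehat{\mathfrak A}_{0,-}$, and $\widehat{\mathfrak A}_1=\widehat{\mathfrak A}_{1,+}\oplus\widehat{\mathfrak A}_{1,-}$. The even and odd parts are related by $$\widehat{\mathfrak A}_{1,+}=\widehat{\mathfrak A}_{0,+},\qquad \widehat{\mathfrak A}_{1,-}=\widehat{\mathfrak A}_{0,-}T,$$ and moreover $\widehat{\mathfrak A}=\widehat{\mathfrak A}_1\oplus\widehat{\mathfrak A}_1T$. -/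

import Mathlib

noncomputable section

namespace ArakiJW

open scoped TensorProduct Matrix.Norms.L2Operator

universe u

/-- The complex `2 × 2` matrices. -/
abbrev M2 : Type := Matrix (Fin 2) (Fin 2) ℂ

/-- The nonempty finite subsets of the configuration space `ℤ`, directed by inclusion. -/
abbrev FinZ : Type := {Λ : Finset ℤ // Λ.Nonempty}

instance : IsDirectedOrder FinZ :=
  ⟨fun Λ Γ => ⟨⟨Λ.1 ∪ Γ.1, Λ.2.mono Finset.subset_union_left⟩,
    Finset.subset_union_left, Finset.subset_union_right⟩⟩

instance : Nonempty FinZ := ⟨⟨{0}, Finset.singleton_nonempty 0⟩⟩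

variable {𝔄 : ℤ → Type u} [∀ x, CStarAlgebra (𝔄 x)] (ξ : ∀ x, 𝔄 x ≃⋆ₐ[ℂ] M2)

/-! ### Local observable algebras -/

/-- The local observable algebra over `Λ`: the algebraic tensor product of the one-site algebras
`𝔄 x`, `x ∈ Λ`, with its factorwise multiplication. Its involution and its `C*`-norm are
introduced below. -/
def LocalAlg (_ξ : ∀ x, 𝔄 x ≃⋆ₐ[ℂ] M2) (Λ : FinZ) : Type u := ⨂[ℂ] x : Λ.1, 𝔄 x

variable (Λ : FinZ)

instance : Ring (LocalAlg ξ Λ) := inferInstanceAs (Ring (⨂[ℂ] x : Λ.1, 𝔄 x))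

instance : Algebra ℂ (LocalAlg ξ Λ) := inferInstanceAs (Algebra ℂ (⨂[ℂ] x : Λ.1, 𝔄 x))

/-- The elementary tensor `⊗_{x ∈ Λ} A x`. -/
def LocalAlg.pure (A : ∀ x : Λ.1, 𝔄 x) : LocalAlg ξ Λ := PiTensorProduct.tprod ℂ A

/-- The matrices of size `2 ^ |Λ|`, with rows and columns indexed by spin configurations. -/
abbrev LocalMat : Type := Matrix (Λ.1 → Fin 2) (Λ.1 → Fin 2) ℂ

/-- The matrix entry `(i, j)` of the Kronecker product of the `ξ x (A x)`. -/
def kronEntry (i j : Λ.1 → Fin 2) : MultilinearMap ℂ (fun x : Λ.1 => 𝔄 x) ℂ :=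
  (MultilinearMap.mkPiAlgebra ℂ Λ.1 ℂ).compLinearMap fun x : Λ.1 =>
    (Matrix.entryLinearMap ℂ ℂ (i x) (j x)).comp (ξ x).toAlgEquiv.toLinearEquiv.toLinearMap

lemma kronEntry_apply (i j : Λ.1 → Fin 2) (A : ∀ x : Λ.1, 𝔄 x) :
    kronEntry ξ Λ i j A = ∏ x : Λ.1, ξ x (A x) (i x) (j x) := by
  simp [kronEntry]

/-- The Kronecker product of the matrices `ξ x (A x)`, `x ∈ Λ`. -/
def kron : MultilinearMap ℂ (fun x : Λ.1 => 𝔄 x) (LocalMat Λ) where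
  toFun A := Matrix.of fun i j => ∏ x : Λ.1, ξ x (A x) (i x) (j x)
  map_update_add' := by
    intro _ A x a b
    ext i j
    have h := (kronEntry ξ Λ i j).map_update_add A x a b
    simp only [kronEntry_apply] at h
    exact h
  map_update_smul' := by
    intro _ A x c a
    ext i j
    have h := (kronEntry ξ Λ i j).map_update_smul A x c a
    simp only [kronEntry_apply] at h
    exact h

lemma kron_apply (A : ∀ x : Λ.1, 𝔄 x) (i j : Λ.1 → Fin 2) :
    kron ξ Λ A i j = ∏ x : Λ.1, ξ x (A x) (i x) (j x) := rfl

/-- The algebra homomorphism given by the Kronecker product on elementary tensors. -/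
def xiHom : LocalAlg ξ Λ →ₐ[ℂ] LocalMat Λ :=
  PiTensorProduct.liftAlgHom (kron ξ Λ)
    (by
      ext i j
      simp only [kron_apply, Pi.one_apply, map_one, Matrix.one_apply, Fintype.prod_ite_zero,
        Finset.prod_const_one, funext_iff])
    (by
      intro A B
      ext i j
      simp only [kron_apply, Pi.mul_apply, map_mul, Matrix.mul_apply, Finset.prod_univ_sum,
        Fintype.piFinset_univ, Finset.prod_mul_distrib])

lemma xiHom_pure (A : ∀ x : Λ.1, 𝔄 x) : xiHom ξ Λ (LocalAlg.pure ξ Λ A) = kron ξ Λ A :=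
  PiTensorProduct.lift.tprod _

variable {ξ Λ} in
lemma LocalAlg.induction {P : LocalAlg ξ Λ → Prop}
    (smul : ∀ (c : ℂ) A, P (c • LocalAlg.pure ξ Λ A)) (add : ∀ A B, P A → P B → P (A + B))
    (A : LocalAlg ξ Λ) : P A :=
  PiTensorProduct.induction_on (motive := P) A smul add

/-- The basis of `𝔄 x` of matrix units. -/
def siteBasis (x : ℤ) : Module.Basis (Fin 2 × Fin 2) ℂ (𝔄 x) :=
  (Matrix.stdBasis ℂ (Fin 2) (Fin 2)).map (ξ x).symm.toAlgEquiv.toLinearEquiv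

lemma siteBasis_repr (x : ℤ) (a : 𝔄 x) (p : Fin 2 × Fin 2) :
    (siteBasis ξ x).repr a p = ξ x a p.1 p.2 := by
  simp [siteBasis, Matrix.stdBasis]

/-- The basis of the local algebra of tensor products of matrix units. -/
def localBasis : Module.Basis (Λ.1 → Fin 2 × Fin 2) ℂ (LocalAlg ξ Λ) :=
  Basis.piTensorProduct fun x : Λ.1 => siteBasis ξ x

lemma xiHom_entry (A : LocalAlg ξ Λ) (i j : Λ.1 → Fin 2) :
    xiHom ξ Λ A i j = (localBasis ξ Λ).repr A fun x => (i x, j x) := by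
  induction A using LocalAlg.induction with
  | smul c A =>
    have h : (localBasis ξ Λ).repr (LocalAlg.pure ξ Λ A) (fun x => (i x, j x))
        = ∏ x : Λ.1, ξ x (A x) (i x) (j x) := by
      refine (Basis.piTensorProduct_repr_tprod_apply _ _ _).trans ?_
      simp only [siteBasis_repr]
    rw [map_smul, map_smul, xiHom_pure, Finsupp.smul_apply, h, Matrix.smul_apply, kron_apply]
  | add A B hA hB => rw [map_add, map_add, Matrix.add_apply, hA, hB, Finsupp.add_apply]

lemma xiHom_bijective : Function.Bijective (xiHom ξ Λ) := by
  constructor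
  · intro A B h
    apply (localBasis ξ Λ).repr.injective
    ext p
    have := congrFun (congrFun h fun x => (p x).1) fun x => (p x).2
    rwa [xiHom_entry, xiHom_entry] at this
  · intro M
    refine ⟨(localBasis ξ Λ).repr.symm (Finsupp.equivFunOnFinite.symm fun p =>
      M (fun x => (p x).1) fun x => (p x).2), ?_⟩
    ext i j
    rw [xiHom_entry, LinearEquiv.apply_symm_apply]
    rfl

/-- The isomorphism `ξ_Λ` of the local algebra with the matrices of size `2 ^ |Λ|`, given by
the Kronecker product on elementary tensors. -/
def xiLoc : LocalAlg ξ Λ ≃ₐ[ℂ] LocalMat Λ := AlgEquiv.ofBijective (xiHom ξ Λ) (xiHom_bijective ξ Λ)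

lemma xiLoc_pure (A : ∀ x : Λ.1, 𝔄 x) : xiLoc ξ Λ (LocalAlg.pure ξ Λ A) = kron ξ Λ A :=
  xiHom_pure ξ Λ A

/-- The involution; it is characterized on elementary tensors by `LocalAlg.star_pure`. -/
instance : StarRing (LocalAlg ξ Λ) where
  star A := (xiLoc ξ Λ).symm (star (xiLoc ξ Λ A))
  star_involutive A := by simp
  star_mul A B := by simp
  star_add A B := by simp

lemma xiLoc_star (A : LocalAlg ξ Λ) : xiLoc ξ Λ (star A) = star (xiLoc ξ Λ A) :=
  (xiLoc ξ Λ).apply_symm_apply _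

instance : StarModule ℂ (LocalAlg ξ Λ) where
  star_smul c A := (xiLoc ξ Λ).injective (by simp [xiLoc_star])

lemma LocalAlg.star_pure (A : ∀ x : Λ.1, 𝔄 x) :
    star (LocalAlg.pure ξ Λ A) = LocalAlg.pure ξ Λ fun x => star (A x) := by
  apply (xiLoc ξ Λ).injective
  rw [xiLoc_star, xiLoc_pure, xiLoc_pure]
  ext i j
  simp only [kron_apply, Matrix.star_apply, map_star, star_prod]

lemma LocalAlg.pure_mul (A B : ∀ x : Λ.1, 𝔄 x) :
    LocalAlg.pure ξ Λ A * LocalAlg.pure ξ Λ B = LocalAlg.pure ξ Λ (A * B) :=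
  PiTensorProduct.tprod_mul_tprod A B

lemma LocalAlg.pure_one : LocalAlg.pure ξ Λ 1 = 1 := rfl

/-- The norm of `A` is the spectral norm of the matrix `ξ_Λ A`. -/
instance : NormedRing (LocalAlg ξ Λ) :=
  NormedRing.induced (LocalAlg ξ Λ) (LocalMat Λ) (xiLoc ξ Λ) (xiLoc ξ Λ).injective

lemma LocalAlg.norm_def (A : LocalAlg ξ Λ) : ‖A‖ = ‖xiLoc ξ Λ A‖ := rfl

instance : NormedAlgebra ℂ (LocalAlg ξ Λ) where
  norm_smul_le c A := by
    rw [LocalAlg.norm_def, LocalAlg.norm_def, map_smul]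
    exact norm_smul_le c _

instance : CStarRing (LocalAlg ξ Λ) where
  norm_mul_self_le A := by
    rw [LocalAlg.norm_def, LocalAlg.norm_def, map_mul, xiLoc_star]
    exact CStarRing.norm_mul_self_le _

instance : FiniteDimensional ℂ (LocalAlg ξ Λ) := (localBasis ξ Λ).finiteDimensional_of_finite

instance : CStarAlgebra (LocalAlg ξ Λ) where
  toCompleteSpace := FiniteDimensional.complete ℂ _

instance : IsSimpleRing (LocalAlg ξ Λ) :=
  IsSimpleRing.of_ringEquiv (xiLoc ξ Λ).symm.toRingEquiv (IsSimpleRing.matrix _ _)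

lemma norm_localHom {Γ : FinZ} (φ : LocalAlg ξ Λ →⋆ₐ[ℂ] LocalAlg ξ Γ) (A : LocalAlg ξ Λ) :
    ‖φ A‖ = ‖A‖ :=
  NonUnitalStarAlgHom.norm_map φ (RingHom.injective (φ : LocalAlg ξ Λ →+* LocalAlg ξ Γ)) A

/-! ### Isotonies and the infinite tensor product -/

variable {Λ} {Γ : FinZ}

/-- The family on `Γ` which extends `A` by the identity outside of `Λ`. -/
def extendOne (Γ : FinZ) (A : ∀ x : Λ.1, 𝔄 x) (y : Γ.1) : 𝔄 y :=
  if h : (y : ℤ) ∈ Λ.1 then A ⟨y, h⟩ else 1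

lemma extendOne_one : extendOne Γ (1 : ∀ x : Λ.1, 𝔄 x) = 1 := by
  ext y
  by_cases h : (y : ℤ) ∈ Λ.1 <;> simp [extendOne, h]

lemma extendOne_mul (A B : ∀ x : Λ.1, 𝔄 x) :
    extendOne Γ (A * B) = extendOne Γ A * extendOne Γ B := by
  ext y
  by_cases h : (y : ℤ) ∈ Λ.1 <;> simp [extendOne, h]

lemma extendOne_star (A : ∀ x : Λ.1, 𝔄 x) :
    extendOne Γ (fun x => star (A x)) = fun y => star (extendOne Γ A y) := by
  ext y
  by_cases h : (y : ℤ) ∈ Λ.1 <;> simp [extendOne, h]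

lemma extendOne_update [DecidableEq Λ.1] (h : Λ ≤ Γ) (A : ∀ x : Λ.1, 𝔄 x) (x : Λ.1) (a : 𝔄 x) :
    extendOne Γ (Function.update A x a)
      = Function.update (extendOne Γ A) (⟨x, h x.2⟩ : Γ.1) a := by
  ext y
  obtain ⟨y, hy⟩ := y
  obtain ⟨x, hx⟩ := x
  by_cases hyx : y = x
  · subst hyx
    simp [extendOne, hx]
  · by_cases hyΛ : y ∈ Λ.1 <;> simp [extendOne, hyΛ, hyx, Function.update]

/-- The multilinear map `A ↦ A ⊗ 1` underlying the isotony. -/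
def isotonyMulti (h : Λ ≤ Γ) : MultilinearMap ℂ (fun x : Λ.1 => 𝔄 x) (LocalAlg ξ Γ) where
  toFun A := LocalAlg.pure ξ Γ (extendOne Γ A)
  map_update_add' := by
    intro _ A x a b
    simp only [extendOne_update h]
    exact (PiTensorProduct.tprod ℂ).map_update_add _ _ _ _
  map_update_smul' := by
    intro _ A x c a
    simp only [extendOne_update h]
    exact (PiTensorProduct.tprod ℂ).map_update_smul _ _ _ _

/-- The isotony as an algebra homomorphism. -/
def isotonyAlgHom (h : Λ ≤ Γ) : LocalAlg ξ Λ →ₐ[ℂ] LocalAlg ξ Γ :=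
  PiTensorProduct.liftAlgHom (isotonyMulti ξ h)
    (by
      change LocalAlg.pure ξ Γ _ = 1
      rw [extendOne_one, LocalAlg.pure_one])
    (fun A B => by
      change LocalAlg.pure ξ Γ _ = LocalAlg.pure ξ Γ _ * LocalAlg.pure ξ Γ _
      rw [extendOne_mul, LocalAlg.pure_mul])

lemma isotonyAlgHom_pure (h : Λ ≤ Γ) (A : ∀ x : Λ.1, 𝔄 x) :
    isotonyAlgHom ξ h (LocalAlg.pure ξ Λ A) = LocalAlg.pure ξ Γ (extendOne Γ A) :=
  PiTensorProduct.lift.tprod _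

/-- The isotony `φ_{Γ,Λ}`, which maps `A` to `A ⊗ 1_{Γ ∖ Λ}`. -/
def isotony (h : Λ ≤ Γ) : LocalAlg ξ Λ →⋆ₐ[ℂ] LocalAlg ξ Γ where
  toAlgHom := isotonyAlgHom ξ h
  map_star' A := by
    change isotonyAlgHom ξ h (star A) = star (isotonyAlgHom ξ h A)
    induction A using LocalAlg.induction with
    | smul c A =>
      rw [star_smul, map_smul, map_smul, star_smul, LocalAlg.star_pure, isotonyAlgHom_pure,
        isotonyAlgHom_pure, LocalAlg.star_pure, extendOne_star]
    | add A B hA hB => rw [star_add, map_add, map_add, star_add, hA, hB]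

lemma isotony_pure (h : Λ ≤ Γ) (A : ∀ x : Λ.1, 𝔄 x) :
    isotony ξ h (LocalAlg.pure ξ Λ A) = LocalAlg.pure ξ Γ (extendOne Γ A) :=
  isotonyAlgHom_pure ξ h A

lemma isotony_refl (A : LocalAlg ξ Λ) : isotony ξ le_rfl A = A := by
  induction A using LocalAlg.induction with
  | smul c A =>
    rw [map_smul, isotony_pure]
    congr 2
    ext x
    simp [extendOne]
  | add A B hA hB => rw [map_add, hA, hB]

lemma isotony_comp {Δ : FinZ} (h : Λ ≤ Γ) (h' : Γ ≤ Δ) (A : LocalAlg ξ Λ) :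
    isotony ξ h' (isotony ξ h A) = isotony ξ (h.trans h') A := by
  induction A using LocalAlg.induction with
  | smul c A =>
    rw [map_smul, map_smul, map_smul, isotony_pure, isotony_pure, isotony_pure]
    congr 2
    ext x
    by_cases hx : (x : ℤ) ∈ Λ.1
    · have hx' : (x : ℤ) ∈ Γ.1 := h hx
      simp [extendOne, hx, hx']
    · simp [extendOne, hx]
  | add A B hA hB => simp only [map_add, hA, hB]

/-- The families `(f_Λ)` which, from some `Λ` on, are given by the isotonies. -/
def coherent : StarSubalgebra ℂ (∀ Λ : FinZ, LocalAlg ξ Λ) where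
  carrier := {f | ∃ Λ, ∀ Γ, ∀ h : Λ ≤ Γ, f Γ = isotony ξ h (f Λ)}
  mul_mem' := by
    rintro f g ⟨Λ, hf⟩ ⟨Γ, hg⟩
    obtain ⟨Δ, h₁, h₂⟩ := exists_ge_ge Λ Γ
    refine ⟨Δ, fun Δ' h => ?_⟩
    rw [Pi.mul_apply, Pi.mul_apply, hf Δ' (h₁.trans h), hg Δ' (h₂.trans h), hf Δ h₁, hg Δ h₂,
      map_mul, isotony_comp, isotony_comp]
  add_mem' := by
    rintro f g ⟨Λ, hf⟩ ⟨Γ, hg⟩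
    obtain ⟨Δ, h₁, h₂⟩ := exists_ge_ge Λ Γ
    refine ⟨Δ, fun Δ' h => ?_⟩
    rw [Pi.add_apply, Pi.add_apply, hf Δ' (h₁.trans h), hg Δ' (h₂.trans h), hf Δ h₁, hg Δ h₂,
      map_add, isotony_comp, isotony_comp]
  algebraMap_mem' c := ⟨Classical.arbitrary FinZ, fun Γ h => by
    rw [Pi.algebraMap_apply, Pi.algebraMap_apply, AlgHomClass.commutes]⟩
  star_mem' := by
    rintro f ⟨Λ, hf⟩
    exact ⟨Λ, fun Γ h => by rw [Pi.star_apply, Pi.star_apply, hf Γ h, map_star]⟩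

/-- The star algebra of the coherent families, to be equipped with the seminorm
`f ↦ lim_Λ ‖f Λ‖`. -/
def PreAlg (ξ : ∀ x, 𝔄 x ≃⋆ₐ[ℂ] M2) : Type u := coherent ξ

instance : Ring (PreAlg ξ) := inferInstanceAs (Ring (coherent ξ))

instance : Algebra ℂ (PreAlg ξ) := inferInstanceAs (Algebra ℂ (coherent ξ))

instance : StarRing (PreAlg ξ) := inferInstanceAs (StarRing (coherent ξ))

instance : StarModule ℂ (PreAlg ξ) := inferInstanceAs (StarModule ℂ (coherent ξ))

variable {ξ}

/-- The component `f_Λ` of a coherent family. -/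
def PreAlg.val (f : PreAlg ξ) (Λ : FinZ) : LocalAlg ξ Λ := f.1 Λ

/-- The seminorm `lim_Λ ‖f Λ‖`. -/
def PreAlg.seminorm (f : PreAlg ξ) : ℝ := Filter.limUnder Filter.atTop fun Λ => ‖f.val Λ‖

lemma PreAlg.eventually_norm (f : PreAlg ξ) :
    ∀ᶠ Λ in Filter.atTop, ‖f.val Λ‖ = f.seminorm := by
  obtain ⟨Λ, hΛ⟩ := f.2
  have h : ∀ Γ, Λ ≤ Γ → ‖f.val Γ‖ = ‖f.val Λ‖ := fun Γ h => by
    rw [PreAlg.val, hΛ Γ h, norm_localHom]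
    rfl
  have ht : Filter.Tendsto (fun Γ => ‖f.val Γ‖) Filter.atTop (nhds ‖f.val Λ‖) :=
    tendsto_const_nhds.congr' ((Filter.eventually_ge_atTop Λ).mono fun Γ hΓ => (h Γ hΓ).symm)
  filter_upwards [Filter.eventually_ge_atTop Λ] with Γ hΓ
  rw [h Γ hΓ, PreAlg.seminorm, ht.limUnder_eq]

variable (ξ) in
/-- The seminorm on the coherent families, bundled. -/
def preSeminorm : AddGroupSeminorm (PreAlg ξ) where
  toFun := PreAlg.seminorm
  map_zero' := by
    obtain ⟨Λ, h⟩ := (PreAlg.eventually_norm (0 : PreAlg ξ)).exists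
    rw [← h]
    exact norm_zero
  add_le' f g := by
    obtain ⟨Λ, ⟨h₁, h₂⟩, h₃⟩ :=
      ((f.eventually_norm.and g.eventually_norm).and (f + g).eventually_norm).exists
    rw [← h₁, ← h₂, ← h₃]
    exact norm_add_le _ _
  neg' f := by
    obtain ⟨Λ, h₁, h₂⟩ := (f.eventually_norm.and (-f).eventually_norm).exists
    rw [← h₁, ← h₂]
    exact norm_neg _

instance : SeminormedRing (PreAlg ξ) where
  __ := (preSeminorm ξ).toSeminormedAddCommGroup
  __ := (inferInstance : Ring (PreAlg ξ))
  norm_mul_le f g := by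
    change (f * g).seminorm ≤ f.seminorm * g.seminorm
    obtain ⟨Λ, ⟨h₁, h₂⟩, h₃⟩ :=
      ((f.eventually_norm.and g.eventually_norm).and (f * g).eventually_norm).exists
    rw [← h₁, ← h₂, ← h₃]
    exact norm_mul_le _ _

lemma PreAlg.norm_def (f : PreAlg ξ) : ‖f‖ = f.seminorm := rfl

lemma PreAlg.norm_eq {f : PreAlg ξ} {c : ℝ} (h : ∀ᶠ Λ in Filter.atTop, ‖f.val Λ‖ = c) :
    ‖f‖ = c := by
  obtain ⟨Λ, h₁, h₂⟩ := (f.eventually_norm.and h).exists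
  rw [PreAlg.norm_def, ← h₁, h₂]

instance : NormedAlgebra ℂ (PreAlg ξ) where
  norm_smul_le c f := by
    refine (PreAlg.norm_eq ?_).le
    filter_upwards [f.eventually_norm] with Λ h
    rw [PreAlg.norm_def, ← h]
    exact norm_smul c _

lemma PreAlg.norm_star (f : PreAlg ξ) : ‖star f‖ = ‖f‖ := by
  refine PreAlg.norm_eq ?_
  filter_upwards [f.eventually_norm] with Λ h
  rw [PreAlg.norm_def, ← h]
  exact _root_.norm_star (f.val Λ)

lemma PreAlg.norm_star_mul_self (f : PreAlg ξ) : ‖star f * f‖ = ‖f‖ * ‖f‖ := by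
  refine PreAlg.norm_eq ?_
  filter_upwards [f.eventually_norm] with Λ h
  rw [PreAlg.norm_def, ← h]
  exact CStarRing.norm_star_mul_self (x := f.val Λ)

/-- The Hausdorff completion of the coherent families with respect to their seminorm. -/
abbrev InfCompl (ξ : ∀ x, 𝔄 x ≃⋆ₐ[ℂ] M2) : Type u := UniformSpace.Completion (PreAlg ξ)

open UniformSpace

lemma isometry_star_pre : Isometry (star : PreAlg ξ → PreAlg ξ) :=
  AddMonoidHomClass.isometry_of_norm (starAddEquiv : PreAlg ξ ≃+ PreAlg ξ) PreAlg.norm_star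

instance : Star (InfCompl ξ) := ⟨Completion.map star⟩

lemma InfCompl.star_coe (f : PreAlg ξ) : star (f : InfCompl ξ) = ((star f : PreAlg ξ) : InfCompl ξ) :=
  Completion.map_coe isometry_star_pre.uniformContinuous f

instance : ContinuousStar (InfCompl ξ) := ⟨Completion.continuous_map⟩

instance : StarRing (InfCompl ξ) where
  star_involutive A := by
    induction A using Completion.induction_on with
    | hp => exact isClosed_eq (continuous_star.comp continuous_star) continuous_id
    | ih f => rw [InfCompl.star_coe, InfCompl.star_coe, star_star]
  star_mul A B := by
    induction A, B using Completion.induction_on₂ with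
    | hp => exact isClosed_eq (by fun_prop) (by fun_prop)
    | ih f g =>
      rw [← Completion.coe_mul, InfCompl.star_coe, InfCompl.star_coe, InfCompl.star_coe, star_mul,
        Completion.coe_mul]
  star_add A B := by
    induction A, B using Completion.induction_on₂ with
    | hp => exact isClosed_eq (by fun_prop) (by fun_prop)
    | ih f g =>
      rw [← Completion.coe_add, InfCompl.star_coe, InfCompl.star_coe, InfCompl.star_coe, star_add,
        Completion.coe_add]

instance : NormedAlgebra ℂ (InfCompl ξ) where
  norm_smul_le := norm_smul_le

instance : StarModule ℂ (InfCompl ξ) where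
  star_smul c A := by
    induction A using Completion.induction_on with
    | hp =>
      have h : ∀ c : ℂ, Continuous fun B : InfCompl ξ => c • B := fun c => continuous_const_smul c
      exact isClosed_eq (continuous_star.comp (h c)) ((h (star c)).comp continuous_star)
    | ih f =>
      rw [← Completion.coe_smul, InfCompl.star_coe, InfCompl.star_coe, star_smul, Completion.coe_smul]

instance : CStarRing (InfCompl ξ) where
  norm_mul_self_le A := by
    induction A using Completion.induction_on with
    | hp => exact isClosed_le (by fun_prop) (by fun_prop)
    | ih f =>
      rw [InfCompl.star_coe, ← Completion.coe_mul, Completion.norm_coe, Completion.norm_coe,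
        PreAlg.norm_star_mul_self]

instance : CStarAlgebra (InfCompl ξ) where

lemma InfCompl.coe_eq {f g : PreAlg ξ} (h : ∀ᶠ Λ in Filter.atTop, f.val Λ = g.val Λ) :
    (f : InfCompl ξ) = g := by
  rw [← sub_eq_zero, ← Completion.coe_sub, ← norm_eq_zero, Completion.norm_coe]
  refine PreAlg.norm_eq ?_
  filter_upwards [h] with Λ h
  change ‖f.val Λ - g.val Λ‖ = 0
  rw [h, sub_self, norm_zero]

/-- The coherent family of the images of `A` under the isotonies. -/
def preEmb (A : LocalAlg ξ Λ) : PreAlg ξ :=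
  ⟨fun Γ => if h : Λ ≤ Γ then isotony ξ h A else 0, Λ, fun Γ h => by
    simp only [h, le_refl, dite_true, isotony_refl]⟩

lemma preEmb_val (A : LocalAlg ξ Λ) (h : Λ ≤ Γ) : (preEmb A).val Γ = isotony ξ h A := by
  simp [PreAlg.val, preEmb, h]

variable (ξ Λ) in
/-- The embedding of the local algebra over `Λ` into the completion. -/
def embCompl : LocalAlg ξ Λ →⋆ₐ[ℂ] InfCompl ξ where
  toFun A := (preEmb A : InfCompl ξ)
  map_one' := InfCompl.coe_eq <| by
    filter_upwards [Filter.eventually_ge_atTop Λ] with Γ h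
    rw [preEmb_val _ h, map_one]
    rfl
  map_mul' A B := by
    rw [← Completion.coe_mul]
    refine InfCompl.coe_eq ?_
    filter_upwards [Filter.eventually_ge_atTop Λ] with Γ h
    change _ = (preEmb A).val Γ * (preEmb B).val Γ
    rw [preEmb_val _ h, preEmb_val _ h, preEmb_val _ h, map_mul]
  map_zero' := InfCompl.coe_eq <| by
    filter_upwards [Filter.eventually_ge_atTop Λ] with Γ h
    rw [preEmb_val _ h, map_zero]
    rfl
  map_add' A B := by
    rw [← Completion.coe_add]
    refine InfCompl.coe_eq ?_
    filter_upwards [Filter.eventually_ge_atTop Λ] with Γ h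
    change _ = (preEmb A).val Γ + (preEmb B).val Γ
    rw [preEmb_val _ h, preEmb_val _ h, preEmb_val _ h, map_add]
  commutes' c := InfCompl.coe_eq <| by
    filter_upwards [Filter.eventually_ge_atTop Λ] with Γ h
    rw [preEmb_val _ h, AlgHomClass.commutes]
    rfl
  map_star' A := by
    rw [InfCompl.star_coe]
    refine InfCompl.coe_eq ?_
    filter_upwards [Filter.eventually_ge_atTop Λ] with Γ h
    change _ = star ((preEmb A).val Γ)
    rw [preEmb_val _ h, preEmb_val _ h, map_star]

section Rotation

variable (θ : ∀ x, 𝔄 x →⋆ₐ[ℂ] 𝔄 x)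

/-- The multilinear map `A ↦ ⊗_{x ∈ Λ} θ x (A x)`. -/
def localEndMulti (ξ : ∀ x, 𝔄 x ≃⋆ₐ[ℂ] M2) (θ : ∀ x, 𝔄 x →⋆ₐ[ℂ] 𝔄 x) (Λ : FinZ) :
    MultilinearMap ℂ (fun x : Λ.1 => 𝔄 x) (LocalAlg ξ Λ) where
  toFun A := LocalAlg.pure ξ Λ fun x => θ x (A x)
  map_update_add' := ((PiTensorProduct.tprod ℂ).compLinearMap
    fun x : Λ.1 => (θ x).toAlgHom.toLinearMap).map_update_add'
  map_update_smul' := ((PiTensorProduct.tprod ℂ).compLinearMap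
    fun x : Λ.1 => (θ x).toAlgHom.toLinearMap).map_update_smul'

/-- The algebra endomorphism of the local algebra which acts by `θ x` on the factor at `x`. -/
def localEndAlg (ξ : ∀ x, 𝔄 x ≃⋆ₐ[ℂ] M2) (θ : ∀ x, 𝔄 x →⋆ₐ[ℂ] 𝔄 x) (Λ : FinZ) :
    LocalAlg ξ Λ →ₐ[ℂ] LocalAlg ξ Λ :=
  PiTensorProduct.liftAlgHom (localEndMulti ξ θ Λ)
    (by
      change LocalAlg.pure ξ Λ (fun x => θ x 1) = 1
      simp only [map_one]
      rfl)
    (fun A B => by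
      change LocalAlg.pure ξ Λ (fun x => θ x (A x * B x))
        = LocalAlg.pure ξ Λ (fun x => θ x (A x)) * LocalAlg.pure ξ Λ (fun x => θ x (B x))
      simp only [map_mul, LocalAlg.pure_mul]
      rfl)

lemma localEndAlg_pure (A : ∀ x : Λ.1, 𝔄 x) :
    localEndAlg ξ θ Λ (LocalAlg.pure ξ Λ A) = LocalAlg.pure ξ Λ fun x => θ x (A x) :=
  PiTensorProduct.lift.tprod _

/-- The star endomorphism of the local algebra which acts by `θ x` on the factor at `x`. -/
def localEnd (ξ : ∀ x, 𝔄 x ≃⋆ₐ[ℂ] M2) (θ : ∀ x, 𝔄 x →⋆ₐ[ℂ] 𝔄 x) (Λ : FinZ) :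
    LocalAlg ξ Λ →⋆ₐ[ℂ] LocalAlg ξ Λ where
  toAlgHom := localEndAlg ξ θ Λ
  map_star' A := by
    change localEndAlg ξ θ Λ (star A) = star (localEndAlg ξ θ Λ A)
    induction A using LocalAlg.induction with
    | smul c A =>
      rw [star_smul, map_smul, map_smul, star_smul, LocalAlg.star_pure, localEndAlg_pure,
        localEndAlg_pure, LocalAlg.star_pure]
      simp only [map_star]
    | add A B hA hB => rw [star_add, map_add, map_add, star_add, hA, hB]

lemma localEnd_pure (A : ∀ x : Λ.1, 𝔄 x) :
    localEnd ξ θ Λ (LocalAlg.pure ξ Λ A) = LocalAlg.pure ξ Λ fun x => θ x (A x) :=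
  localEndAlg_pure θ A

lemma isotony_localEnd (h : Λ ≤ Γ) (A : LocalAlg ξ Λ) :
    isotony ξ h (localEnd ξ θ Λ A) = localEnd ξ θ Γ (isotony ξ h A) := by
  induction A using LocalAlg.induction with
  | smul c A =>
    rw [map_smul, map_smul, map_smul, map_smul, localEnd_pure, isotony_pure, isotony_pure,
      localEnd_pure]
    congr 2
    ext y
    by_cases hy : (y : ℤ) ∈ Λ.1 <;> simp [extendOne, hy]
  | add A B hA hB => simp only [map_add, hA, hB]

/-- The componentwise action on the coherent families. -/
def preEnd (f : PreAlg ξ) : PreAlg ξ :=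
  ⟨fun Λ => localEnd ξ θ Λ (f.val Λ), by
    obtain ⟨Λ, hΛ⟩ := f.2
    refine ⟨Λ, fun Γ h => ?_⟩
    rw [isotony_localEnd]
    exact congrArg _ (hΛ Γ h)⟩

lemma preEnd_val (f : PreAlg ξ) : (preEnd θ f).val Λ = localEnd ξ θ Λ (f.val Λ) := rfl

lemma isometry_preEnd : Isometry (preEnd (ξ := ξ) θ) := by
  refine Isometry.of_dist_eq fun f g => ?_
  rw [dist_eq_norm, dist_eq_norm]
  refine PreAlg.norm_eq ?_
  filter_upwards [(f - g).eventually_norm] with Λ h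
  rw [PreAlg.norm_def, ← h]
  change ‖localEnd ξ θ Λ (f.val Λ) - localEnd ξ θ Λ (g.val Λ)‖ = ‖f.val Λ - g.val Λ‖
  rw [← map_sub, norm_localHom]

/-- The extension to the completion of the family of the `localEnd ξ θ Λ`. -/
def endCompl (ξ : ∀ x, 𝔄 x ≃⋆ₐ[ℂ] M2) (θ : ∀ x, 𝔄 x →⋆ₐ[ℂ] 𝔄 x) (A : InfCompl ξ) : InfCompl ξ :=
  Completion.map (preEnd θ) A

lemma endCompl_coe (f : PreAlg ξ) : endCompl ξ θ (f : InfCompl ξ) = (preEnd θ f : InfCompl ξ) :=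
  Completion.map_coe (isometry_preEnd θ).uniformContinuous f

lemma continuous_endCompl : Continuous (endCompl ξ θ) := Completion.continuous_map

lemma endCompl_emb (A : LocalAlg ξ Λ) : endCompl ξ θ (embCompl ξ Λ A) = embCompl ξ Λ (localEnd ξ θ Λ A) := by
  change endCompl ξ θ (preEmb A : InfCompl ξ) = (preEmb (localEnd ξ θ Λ A) : InfCompl ξ)
  rw [endCompl_coe]
  refine InfCompl.coe_eq ?_
  filter_upwards [Filter.eventually_ge_atTop Λ] with Γ h
  rw [preEnd_val, preEmb_val _ h, preEmb_val _ h, isotony_localEnd]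

lemma endCompl_endCompl {θ : ∀ x, 𝔄 x →⋆ₐ[ℂ] 𝔄 x} (hθ : ∀ x A, θ x (θ x A) = A) (A : InfCompl ξ) :
    endCompl ξ θ (endCompl ξ θ A) = A := by
  induction A using Completion.induction_on with
  | hp => exact isClosed_eq ((continuous_endCompl θ).comp (continuous_endCompl θ)) continuous_id
  | ih f =>
    rw [endCompl_coe, endCompl_coe]
    refine InfCompl.coe_eq (Filter.Eventually.of_forall fun Λ => ?_)
    rw [preEnd_val, preEnd_val]
    generalize f.val Λ = A
    induction A using LocalAlg.induction with
    | smul c A => simp only [map_smul, localEnd_pure, hθ]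
    | add A B hA hB => simp only [map_add, hA, hB]

/-- `endCompl` as a star automorphism, for involutive one-site automorphisms. -/
def autCompl (ξ : ∀ x, 𝔄 x ≃⋆ₐ[ℂ] M2) (θ : ∀ x, 𝔄 x →⋆ₐ[ℂ] 𝔄 x)
    (hθ : ∀ x A, θ x (θ x A) = A) : InfCompl ξ ≃⋆ₐ[ℂ] InfCompl ξ where
  toFun := endCompl ξ θ
  invFun := endCompl ξ θ
  left_inv := endCompl_endCompl hθ
  right_inv := endCompl_endCompl hθ
  map_mul' A B := by
    have hc := continuous_endCompl (ξ := ξ) θ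
    induction A, B using Completion.induction_on₂ with
    | hp => exact isClosed_eq (by fun_prop) (by fun_prop)
    | ih f g =>
      rw [← Completion.coe_mul, endCompl_coe, endCompl_coe, endCompl_coe, ← Completion.coe_mul]
      exact InfCompl.coe_eq (Filter.Eventually.of_forall fun Λ => map_mul _ _ _)
  map_add' A B := by
    have hc := continuous_endCompl (ξ := ξ) θ
    induction A, B using Completion.induction_on₂ with
    | hp => exact isClosed_eq (by fun_prop) (by fun_prop)
    | ih f g =>
      rw [← Completion.coe_add, endCompl_coe, endCompl_coe, endCompl_coe, ← Completion.coe_add]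
      exact InfCompl.coe_eq (Filter.Eventually.of_forall fun Λ => map_add _ _ _)
  map_star' A := by
    have hc := continuous_endCompl (ξ := ξ) θ
    induction A using Completion.induction_on with
    | hp => exact isClosed_eq (hc.comp continuous_star) (continuous_star.comp hc)
    | ih f =>
      rw [InfCompl.star_coe, endCompl_coe, endCompl_coe, InfCompl.star_coe]
      exact InfCompl.coe_eq (Filter.Eventually.of_forall fun Λ => map_star _ _)
  map_smul' c A := by
    have hc := continuous_endCompl (ξ := ξ) θ
    have h : ∀ c : ℂ, Continuous fun B : InfCompl ξ => c • B := fun c => continuous_const_smul c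
    induction A using Completion.induction_on with
    | hp => exact isClosed_eq (hc.comp (h c)) ((h c).comp hc)
    | ih f =>
      rw [← Completion.coe_smul, endCompl_coe, endCompl_coe, ← Completion.coe_smul]
      exact InfCompl.coe_eq (Filter.Eventually.of_forall fun Λ => map_smul (localEnd ξ θ Λ) c (f.val Λ))

end Rotation

/-- The infinite tensor product `𝔄`: the inductive limit of the local algebras along the
isotonies, i.e. the Hausdorff completion of the coherent families. -/
def InfAlg (ξ : ∀ x, 𝔄 x ≃⋆ₐ[ℂ] M2) : Type u := InfCompl ξ

instance : CStarAlgebra (InfAlg ξ) := inferInstanceAs (CStarAlgebra (InfCompl ξ))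

variable (ξ Λ) in
/-- The embedding `φ_Λ` of the local algebra over `Λ` into the infinite tensor product. -/
def emb : LocalAlg ξ Λ →⋆ₐ[ℂ] InfAlg ξ := embCompl ξ Λ

lemma emb_isotony (h : Λ ≤ Γ) (A : LocalAlg ξ Λ) : emb ξ Γ (isotony ξ h A) = emb ξ Λ A := by
  refine InfCompl.coe_eq ?_
  filter_upwards [Filter.eventually_ge_atTop Γ] with Δ hΔ
  rw [preEmb_val _ hΔ, preEmb_val _ (h.trans hΔ), isotony_comp]

lemma norm_emb (A : LocalAlg ξ Λ) : ‖emb ξ Λ A‖ = ‖A‖ := by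
  refine (Completion.norm_coe (preEmb A)).trans (PreAlg.norm_eq ?_)
  filter_upwards [Filter.eventually_ge_atTop Λ] with Γ h
  rw [preEmb_val _ h, norm_localHom]

/-- The union of the embedded local algebras is dense in the infinite tensor product. -/
lemma dense_iUnion_range_emb : Dense (⋃ Λ, Set.range (emb ξ Λ)) := by
  refine (Completion.denseRange_coe (α := PreAlg ξ)).mono ?_
  rintro _ ⟨f, rfl⟩
  obtain ⟨Λ, hΛ⟩ := f.2
  refine Set.mem_iUnion.2 ⟨Λ, f.val Λ, InfCompl.coe_eq ?_⟩
  filter_upwards [Filter.eventually_ge_atTop Λ] with Γ h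
  rw [preEmb_val _ h]
  exact (hΛ Γ h).symm

/-- The star automorphism of the infinite tensor product which acts by the involutive star
automorphism `θ x` on the factor at `x`, for all sites `x`; see `infAut_emb`. -/
def infAut (ξ : ∀ x, 𝔄 x ≃⋆ₐ[ℂ] M2) (θ : ∀ x, 𝔄 x →⋆ₐ[ℂ] 𝔄 x)
    (hθ : ∀ x A, θ x (θ x A) = A) : InfAlg ξ ≃⋆ₐ[ℂ] InfAlg ξ := autCompl ξ θ hθ

lemma infAut_emb {θ : ∀ x, 𝔄 x →⋆ₐ[ℂ] 𝔄 x} (hθ : ∀ x A, θ x (θ x A) = A)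
    (A : LocalAlg ξ Λ) : infAut ξ θ hθ (emb ξ Λ A) = emb ξ Λ (localEnd ξ θ Λ A) :=
  endCompl_emb θ A

lemma infAut_infAut {θ : ∀ x, 𝔄 x →⋆ₐ[ℂ] 𝔄 x} (hθ : ∀ x A, θ x (θ x A) = A)
    (A : InfAlg ξ) : infAut ξ θ hθ (infAut ξ θ hθ A) = A :=
  endCompl_endCompl hθ A

/-! ### Spin observables -/

/-- The Pauli basis of the complex `2 × 2` matrices, with `pauli 0 = 1`. -/
def pauli : Fin 4 → M2 :=
  ![1, !![0, 1; 1, 0], !![0, -Complex.I; Complex.I, 0], !![1, 0; 0, -1]]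

/-- The sign by which the rotation around the 3-axis by the angle `π` acts on `pauli κ`. -/
def pauliSign : Fin 4 → ℂ := ![1, -1, -1, 1]

variable (ξ)

/-- The spin observable `σ_κ^{(x),Λ}` in the local algebra over `Λ`, for `x ∈ Λ`. -/
def spinLoc (Λ : FinZ) (κ : Fin 4) (x : Λ.1) : LocalAlg ξ Λ :=
  LocalAlg.pure ξ Λ (Pi.mulSingle x ((ξ x).symm (pauli κ)))

/-- The one-point subset `{x}`. -/
def site (x : ℤ) : FinZ := ⟨{x}, Finset.singleton_nonempty x⟩

/-- The spin observable `σ_κ^{(x)}` in the infinite tensor product. -/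
def spin (κ : Fin 4) (x : ℤ) : InfAlg ξ :=
  emb ξ (site x) (spinLoc ξ (site x) κ ⟨x, Finset.mem_singleton_self x⟩)

/-- The definition of `σ_κ^{(x)}` does not depend on the choice of `Λ`. -/
lemma spin_eq (κ : Fin 4) (Λ : FinZ) (x : Λ.1) : spin ξ κ x = emb ξ Λ (spinLoc ξ Λ κ x) := by
  have h : site x ≤ Λ := Finset.singleton_subset_iff.2 x.2
  rw [spin, ← emb_isotony h, spinLoc, spinLoc, isotony_pure]
  congr 2
  ext ⟨y, hy⟩
  obtain ⟨x, hx⟩ := x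
  by_cases hyx : y = x
  · subst hyx
    simp only [extendOne, site, Pi.mulSingle_eq_same]
    refine (dif_pos (Finset.mem_singleton_self y)).trans ?_
    exact dif_pos rfl
  · simp [extendOne, site, hyx]

/-- The lowering operator `σ_-^{(x)}`. -/
def lowering (x : ℤ) : InfAlg ξ := (1 / 2 : ℂ) • (spin ξ 1 x - Complex.I • spin ξ 2 x)

/-- The nonlocal multiplicator `S_x`, the product of the `σ_3^{(y)}` over `1 ≤ y ≤ x - 1`
if `x ≥ 1` and over `x ≤ y ≤ 0` if `x ≤ 0`. -/
def multiplicator (x : ℤ) : InfAlg ξ :=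
  if 1 ≤ x then ((Int.range 1 x).map (spin ξ 3)).prod
  else ((Int.range x 1).map (spin ξ 3)).prod

/-! ### Spin rotations -/

lemma pauli_three_mul_self : pauli 3 * pauli 3 = 1 := by
  ext i j
  fin_cases i <;> fin_cases j <;> simp [pauli]

lemma star_pauli_three : star (pauli 3) = pauli 3 := by
  ext i j
  fin_cases i <;> fin_cases j <;> simp [pauli]

/-- The rotation around the 3-axis by the angle `π` at the site `x`, i.e. conjugation
by `pauli 3`. -/
def siteRot (x : ℤ) : 𝔄 x →⋆ₐ[ℂ] 𝔄 x where
  toFun A := (ξ x).symm (pauli 3 * ξ x A * pauli 3)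
  map_one' := by simp [pauli_three_mul_self]
  map_mul' A B := by
    rw [← map_mul, map_mul (ξ x)]
    congr 1
    calc pauli 3 * (ξ x A * ξ x B) * pauli 3
        = pauli 3 * ξ x A * 1 * ξ x B * pauli 3 := by simp only [mul_assoc, one_mul]
      _ = _ := by rw [← pauli_three_mul_self]; simp only [mul_assoc]
  map_zero' := by simp
  map_add' A B := by simp [mul_add, add_mul]
  commutes' c := by simp [Algebra.algebraMap_eq_smul_one, pauli_three_mul_self]
  map_star' A := by
    rw [← map_star, map_star (ξ x), star_mul, star_mul, star_pauli_three, mul_assoc]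

lemma siteRot_siteRot (x : ℤ) (A : 𝔄 x) : siteRot ξ x (siteRot ξ x A) = A := by
  change (ξ x).symm (pauli 3 * ξ x ((ξ x).symm (pauli 3 * ξ x A * pauli 3)) * pauli 3) = A
  rw [StarAlgEquiv.apply_symm_apply]
  have : pauli 3 * (pauli 3 * ξ x A * pauli 3) * pauli 3 = ξ x A := by
    calc _ = (pauli 3 * pauli 3) * ξ x A * (pauli 3 * pauli 3) := by simp only [mul_assoc]
      _ = _ := by rw [pauli_three_mul_self, one_mul, mul_one]
  rw [this, StarAlgEquiv.symm_apply_apply]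

lemma siteRot_pauli (x : ℤ) (κ : Fin 4) :
    siteRot ξ x ((ξ x).symm (pauli κ)) = pauliSign κ • (ξ x).symm (pauli κ) := by
  change (ξ x).symm (pauli 3 * ξ x ((ξ x).symm (pauli κ)) * pauli 3) = _
  rw [StarAlgEquiv.apply_symm_apply, ← map_smul]
  congr 1
  ext i j
  fin_cases κ <;> fin_cases i <;> fin_cases j <;> simp [pauli, pauliSign]

/-- The rotation at `x` if `x ≤ 0`, and the identity if `x ≥ 1`. -/
def siteHalfRot (x : ℤ) : 𝔄 x →⋆ₐ[ℂ] 𝔄 x :=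
  if 1 ≤ x then StarAlgHom.id ℂ (𝔄 x) else siteRot ξ x

lemma siteHalfRot_siteHalfRot (x : ℤ) (A : 𝔄 x) : siteHalfRot ξ x (siteHalfRot ξ x A) = A := by
  unfold siteHalfRot
  split_ifs
  · rfl
  · exact siteRot_siteRot ξ x A

/-- The spin rotation `Θ`: the rotation around the 3-axis by the angle `π` on all sites. -/
def Theta : InfAlg ξ ≃⋆ₐ[ℂ] InfAlg ξ := infAut ξ (siteRot ξ) (siteRot_siteRot ξ)

/-- The spin rotation `Θ'`: the rotation around the 3-axis by the angle `π` on all sites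
`x ≤ 0`, and the identity on all sites `x ≥ 1`. -/
def Theta' : InfAlg ξ ≃⋆ₐ[ℂ] InfAlg ξ := infAut ξ (siteHalfRot ξ) (siteHalfRot_siteHalfRot ξ)

lemma Theta'_Theta' (A : InfAlg ξ) : Theta' ξ (Theta' ξ A) = A :=
  infAut_infAut (siteHalfRot_siteHalfRot ξ) A

lemma infAut_spin {θ : ∀ x, 𝔄 x →⋆ₐ[ℂ] 𝔄 x} (hθ : ∀ x A, θ x (θ x A) = A) (κ : Fin 4) (x : ℤ) (c : ℂ)
    (h : θ x ((ξ x).symm (pauli κ)) = c • (ξ x).symm (pauli κ)) :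
    infAut ξ θ hθ (spin ξ κ x) = c • spin ξ κ x := by
  rw [spin, infAut_emb, ← map_smul, spinLoc, localEnd_pure]
  congr 1
  set x₀ : (site x).1 := ⟨x, Finset.mem_singleton_self x⟩
  have key := (PiTensorProduct.tprod ℂ).map_update_smul (1 : ∀ y : (site x).1, 𝔄 y) x₀ c
    ((ξ x).symm (pauli κ))
  refine Eq.trans ?_ key
  change PiTensorProduct.tprod ℂ _ = _
  congr 1
  ext ⟨y, hy⟩
  obtain rfl : y = x := Finset.mem_singleton.1 hy
  simp [x₀, h]

/-- The action of `Θ` on the spin observables, which determines it. -/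
lemma Theta_spin (κ : Fin 4) (x : ℤ) : Theta ξ (spin ξ κ x) = pauliSign κ • spin ξ κ x :=
  infAut_spin ξ (siteRot_siteRot ξ) κ x _ (siteRot_pauli ξ x κ)

/-- The action of `Θ'` on the spin observables, which determines it. -/
lemma Theta'_spin (κ : Fin 4) (x : ℤ) :
    Theta' ξ (spin ξ κ x) = if 1 ≤ x then spin ξ κ x else pauliSign κ • spin ξ κ x := by
  split_ifs with hx
  · refine (infAut_spin ξ (siteHalfRot_siteHalfRot ξ) κ x 1 ?_).trans (one_smul _ _)
    simp [siteHalfRot, hx]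
  · refine infAut_spin ξ (siteHalfRot_siteHalfRot ξ) κ x _ ?_
    simpa [siteHalfRot, hx] using siteRot_pauli ξ x κ

/-! ### The crossed product extension -/

instance : PartialOrder (InfAlg ξ) := CStarAlgebra.spectralOrder _

instance : StarOrderedRing (InfAlg ξ) := CStarAlgebra.spectralOrderedRing _

/-- The matrix with rows `(A, B)` and `(Θ' B, Θ' A)`. The type `CStarMatrix` carries the norm of
the operators on the Hilbert `C*`-module of pairs. -/
def hatMatrix (A B : InfAlg ξ) : CStarMatrix (Fin 2) (Fin 2) (InfAlg ξ) :=
  CStarMatrix.ofMatrix !![A, B; Theta' ξ B, Theta' ξ A]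

lemma hatMatrix_add (A B C D : InfAlg ξ) :
    hatMatrix ξ A B + hatMatrix ξ C D = hatMatrix ξ (A + C) (B + D) := by
  ext i j
  fin_cases i <;> fin_cases j <;> simp [hatMatrix]

lemma hatMatrix_mul (A B C D : InfAlg ξ) :
    hatMatrix ξ A B * hatMatrix ξ C D
      = hatMatrix ξ (A * C + B * Theta' ξ D) (A * D + B * Theta' ξ C) := by
  ext i j
  fin_cases i <;> fin_cases j <;>
    simp [hatMatrix, CStarMatrix.mul_apply, Fin.sum_univ_two, Theta'_Theta', add_comm]

lemma hatMatrix_star (A B : InfAlg ξ) :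
    star (hatMatrix ξ A B) = hatMatrix ξ (star A) (star (Theta' ξ B)) := by
  ext i j
  fin_cases i <;> fin_cases j <;>
    simp [hatMatrix, CStarMatrix.star_apply, Theta'_Theta', map_star]

lemma hatMatrix_algebraMap (c : ℂ) :
    hatMatrix ξ (algebraMap ℂ _ c) 0 = algebraMap ℂ _ c := by
  ext i j
  fin_cases i <;> fin_cases j <;>
    simp [hatMatrix, CStarMatrix.algebraMap_apply, Algebra.algebraMap_eq_smul_one]

/-- The crossed product extension `𝔄̂` of the infinite tensor product. -/
def Hat : StarSubalgebra ℂ (CStarMatrix (Fin 2) (Fin 2) (InfAlg ξ)) where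
  carrier := {X | ∃ A B, X = hatMatrix ξ A B}
  mul_mem' := by
    rintro _ _ ⟨A, B, rfl⟩ ⟨C, D, rfl⟩
    exact ⟨_, _, hatMatrix_mul ξ A B C D⟩
  add_mem' := by
    rintro _ _ ⟨A, B, rfl⟩ ⟨C, D, rfl⟩
    exact ⟨_, _, hatMatrix_add ξ A B C D⟩
  algebraMap_mem' c := ⟨_, _, (hatMatrix_algebraMap ξ c).symm⟩
  star_mem' := by
    rintro _ ⟨A, B, rfl⟩
    exact ⟨_, _, hatMatrix_star ξ A B⟩

/-- The embedding `ψ` of the infinite tensor product, `ψ A = diag (A, Θ' A)`. -/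
def psi : InfAlg ξ →⋆ₐ[ℂ] Hat ξ where
  toFun A := ⟨hatMatrix ξ A 0, A, 0, rfl⟩
  map_one' := Subtype.ext (by simpa using hatMatrix_algebraMap ξ 1)
  map_mul' A B := Subtype.ext (by simp [hatMatrix_mul])
  map_zero' := Subtype.ext (by simpa using hatMatrix_algebraMap ξ 0)
  map_add' A B := Subtype.ext (by simp [hatMatrix_add])
  commutes' c := Subtype.ext (hatMatrix_algebraMap ξ c)
  map_star' A := Subtype.ext (by simp [hatMatrix_star])

/-- The spin subalgebra `𝔄̂₀` of the matrices `diag (A, Θ' A)`. -/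
def Hat0 : Set (Hat ξ) := Set.range (psi ξ)

/-- The anchor element `T`, the matrix with rows `(0, 1)` and `(1, 0)`. -/
def anchor : Hat ξ := ⟨hatMatrix ξ 0 1, 0, 1, rfl⟩

/-- The annihilation operator `a_x = T ψ(S_x σ_-^{(x)})`. -/
def annihilation (x : ℤ) : Hat ξ := anchor ξ * psi ξ (multiplicator ξ x * lowering ξ x)

/-- The CAR subalgebra `𝔄̂₁`, the intersection of all `C*`-subalgebras of `𝔄̂` (closed star
subalgebras, not assumed to be unital) which contain all annihilation operators. -/
def Hat1 : Set (Hat ξ) :=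
  ⋂ B ∈ {B : NonUnitalStarSubalgebra ℂ (Hat ξ) |
    IsClosed (B : Set (Hat ξ)) ∧ Set.range (annihilation ξ) ⊆ B}, (B : Set (Hat ξ))

/-! ### Even and odd parts -/

variable {ξ}

/-- The even part of `C` with respect to `θ`. -/
def evenPart (θ : Hat ξ ≃⋆ₐ[ℂ] Hat ξ) (C : Set (Hat ξ)) : Set (Hat ξ) := {A ∈ C | θ A = A}

/-- The odd part of `C` with respect to `θ`. -/
def oddPart (θ : Hat ξ ≃⋆ₐ[ℂ] Hat ξ) (C : Set (Hat ξ)) : Set (Hat ξ) := {A ∈ C | θ A = -A}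

/-- The set `C T` of the products `A T`, `A ∈ C`. -/
def mulAnchor (C : Set (Hat ξ)) : Set (Hat ξ) := (fun A => A * anchor ξ) '' C

/-- `C` is a `C*`-subalgebra of `𝔄̂` which contains the identity of `𝔄̂`. -/
def IsUnitalCStarSubalgebra (C : Set (Hat ξ)) : Prop :=
  IsClosed C ∧ ∃ B : StarSubalgebra ℂ (Hat ξ), (B : Set (Hat ξ)) = C

/-- `C` is a norm closed vector subspace of `𝔄̂` which is invariant under the involution. -/
def IsClosedStarSubspace (C : Set (Hat ξ)) : Prop :=
  IsClosed C ∧ (∃ W : Submodule ℂ (Hat ξ), (W : Set (Hat ξ)) = C) ∧ ∀ A ∈ C, star A ∈ C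

/-- `V` and `W` are vector subspaces of `𝔄̂` and `U` is their internal direct sum. -/
def IsDirectSum (U V W : Set (Hat ξ)) : Prop :=
  ∃ V' W' : Submodule ℂ (Hat ξ), (V' : Set (Hat ξ)) = V ∧ (W' : Set (Hat ξ)) = W ∧
    ((V' ⊔ W' : Submodule ℂ (Hat ξ)) : Set (Hat ξ)) = U ∧ Disjoint V' W'

end ArakiJW

end

open ArakiJW

noncomputable section

namespace ArakiJW

open scoped TensorProduct Matrix.Norms.L2Operator

universe u

variable {𝔄 : ℤ → Type u} [∀ x, CStarAlgebra (𝔄 x)] (ξ : ∀ x, 𝔄 x ≃⋆ₐ[ℂ] M2)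

/-! Every element of `Hat ξ` is determined by its first row `(A, B)` and equals `psi A + psi B * T`,
where `T` squares to one and moving it past `psi A` turns `A` into `Θ' A`. This gives uniqueness in
(a). Existence holds because acting by `Θ` on all entries respects products and adjoints, as `Θ`
commutes with `Θ'`.

Two commuting gradings are now present: the parity under `Θ` of the entries, and the splitting into
diagonal and off-diagonal matrices. The spin subalgebra is the diagonal part. The heart of the proof
is `Hat1_eq`: the CAR subalgebra is the part on which both gradings agree, that is, `A` is even and
`B` is odd. Granted this, (b) and (c) are read off from the coordinates, since right multiplication
by `T` swaps `A` and `B`, and an entry that is both even and odd vanishes.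

In `Hat1_eq`, one inclusion holds because `a_x` is off-diagonal with odd entry and the two
conditions define a closed star subalgebra. The other inverts the Jordan–Wigner transformation
inside the CAR subalgebra: `1` is the anticommutator of `a_1` and its adjoint (`one_mem_carSub`),
`σ_3` is quadratic in `a_x` (`psi_spin_three_mem`), hence `S_x` is available and can be cancelled
(`lowering_mem`). Conjugation by `T` only changes signs of the `a_x`, so it preserves the CAR
subalgebra (`hatMk_Theta'_mem`). Consequently the elements of `𝔄` whose even part, and whose odd
part times `T`, lie in the CAR subalgebra form a closed subalgebra containing all spin observables,
which is everything (`mem_carPreimage`). -/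

/-! ### Generation of the infinite tensor product by the spin observables -/

/-- The embedding of the one-site matrix algebra at `x` into the infinite tensor product. -/
def siteHom (x : ℤ) : M2 →ₐ[ℂ] InfAlg ξ :=
  ((emb ξ (site x)).toAlgHom.comp
    (PiTensorProduct.singleAlgHom (R := ℂ) (A := fun y : (site x).1 => 𝔄 y)
      ⟨x, Finset.mem_singleton_self x⟩)).comp (ξ x).symm.toAlgEquiv.toAlgHom

lemma siteHom_pauli (κ : Fin 4) (x : ℤ) : siteHom ξ x (pauli κ) = spin ξ κ x := rfl

lemma siteHom_apply (x : ℤ) (M : M2) : siteHom ξ x M = emb ξ (site x) (LocalAlg.pure ξ (site x)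
    (Pi.mulSingle ⟨x, Finset.mem_singleton_self x⟩ ((ξ x).symm M))) := rfl

lemma siteHom_star (x : ℤ) (M : M2) : siteHom ξ x (star M) = star (siteHom ξ x M) := by
  rw [siteHom_apply, siteHom_apply, ← map_star (emb ξ (site x)), LocalAlg.star_pure, map_star (ξ x).symm]
  congr 2
  ext ⟨y, hy⟩
  obtain rfl : y = x := Finset.mem_singleton.1 hy
  simp

/-- The Pauli matrices are orthogonal for the trace form: the coefficient of `pauli κ` is half the
trace of `pauli κ * M`. -/
lemma matrix_eq_pauli (M : M2) : M = ((M 0 0 + M 1 1) / 2) • pauli 0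
    + ((M 0 1 + M 1 0) / 2) • pauli 1 + (Complex.I * (M 0 1 - M 1 0) / 2) • pauli 2
    + ((M 0 0 - M 1 1) / 2) • pauli 3 := by
  ext i j
  fin_cases i <;> fin_cases j <;> simp [pauli] <;> ring_nf <;> simp <;> ring

/-- An elementary tensor is a finite product of one-site tensors, and each of these is a linear
combination of spin observables by `matrix_eq_pauli`. -/
lemma emb_mem_of_spin_mem (W : Subalgebra ℂ (InfAlg ξ)) (h : ∀ κ x, spin ξ κ x ∈ W)
    (Λ : FinZ) (A : LocalAlg ξ Λ) : emb ξ Λ A ∈ W := by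
  classical
  have hs : ∀ (x : Λ.1) (a : 𝔄 x), emb ξ Λ (LocalAlg.pure ξ Λ (Pi.mulSingle x a)) ∈ W := by
    intro x a
    let j : M2 →ₐ[ℂ] InfAlg ξ := ((emb ξ Λ).toAlgHom.comp
      (PiTensorProduct.singleAlgHom (R := ℂ) (A := fun y : Λ.1 => 𝔄 y) x)).comp
        (ξ x).symm.toAlgEquiv.toAlgHom
    have hj : ∀ κ, j (pauli κ) ∈ W := by
      intro κ
      have : j (pauli κ) = spin ξ κ x := (spin_eq ξ κ Λ x).symm
      rw [this]
      exact h κ x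
    have hM : ∀ M, j M ∈ W := by
      intro M
      rw [matrix_eq_pauli M, map_add, map_add, map_add, map_smul, map_smul, map_smul, map_smul]
      exact add_mem (add_mem (add_mem (W.smul_mem (hj 0) _) (W.smul_mem (hj 1) _))
        (W.smul_mem (hj 2) _)) (W.smul_mem (hj 3) _)
    have ha : j (ξ x a) = emb ξ Λ (LocalAlg.pure ξ Λ (Pi.mulSingle x a)) := by
      change emb ξ Λ (LocalAlg.pure ξ Λ (Pi.mulSingle x ((ξ x).symm (ξ x a)))) = _
      rw [StarAlgEquiv.symm_apply_apply]
    exact ha ▸ hM _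
  induction A using LocalAlg.induction with
  | smul c A =>
    rw [map_smul]
    refine W.smul_mem ?_ c
    -- The factors of `A` are switched on one site at a time, with the identity at the remaining
    -- sites.
    have key : ∀ s : Finset Λ.1, emb ξ Λ (LocalAlg.pure ξ Λ (s.piecewise A 1)) ∈ W := by
      intro s
      induction s using Finset.induction_on with
      | empty =>
        rw [Finset.piecewise_empty, LocalAlg.pure_one, map_one]
        exact one_mem W
      | insert x s hx ih =>
        have : (insert x s).piecewise A 1 = s.piecewise A 1 * Pi.mulSingle x (A x) := by
          ext y
          by_cases hy : y = x
          · subst hy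
            simp [hx]
          · by_cases hs : y ∈ s <;> simp [hy, hs]
        rw [this, ← LocalAlg.pure_mul, map_mul]
        exact mul_mem ih (hs x (A x))
    have := key Finset.univ
    rwa [Finset.piecewise_univ] at this
  | add A B hA hB => rw [map_add]; exact add_mem hA hB

/-- The spin observables generate the infinite tensor product. -/
lemma mem_of_spin_mem (W : Subalgebra ℂ (InfAlg ξ)) (hW : IsClosed (W : Set (InfAlg ξ)))
    (h : ∀ κ x, spin ξ κ x ∈ W) (A : InfAlg ξ) : A ∈ W := by
  have hsub : (⋃ Λ, Set.range (emb ξ Λ)) ⊆ (W : Set (InfAlg ξ)) := by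
    rintro _ hA
    obtain ⟨Λ, B, rfl⟩ := Set.mem_iUnion.1 hA
    exact emb_mem_of_spin_mem ξ W h Λ B
  have := closure_minimal hsub hW
  rw [dense_iUnion_range_emb.closure_eq] at this
  exact this (Set.mem_univ A)

/-! ### The spin rotations -/

lemma continuous_Theta : Continuous (Theta ξ) := continuous_endCompl _

lemma continuous_Theta' : Continuous (Theta' ξ) := continuous_endCompl _

lemma Theta_Theta (A : InfAlg ξ) : Theta ξ (Theta ξ A) = A := infAut_infAut (siteRot_siteRot ξ) A

/-- The spin rotations commute. -/
lemma Theta_Theta' (A : InfAlg ξ) : Theta ξ (Theta' ξ A) = Theta' ξ (Theta ξ A) := by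
  let f : InfAlg ξ →ₐ[ℂ] InfAlg ξ :=
    (Theta ξ).toAlgEquiv.toAlgHom.comp (Theta' ξ).toAlgEquiv.toAlgHom
  let g : InfAlg ξ →ₐ[ℂ] InfAlg ξ :=
    (Theta' ξ).toAlgEquiv.toAlgHom.comp (Theta ξ).toAlgEquiv.toAlgHom
  -- The two compositions agree on a closed subalgebra, so only the generators matter; there both
  -- rotations act by scalars.
  refine mem_of_spin_mem ξ (AlgHom.equalizer f g) ?_ ?_ A
  · exact isClosed_eq ((continuous_Theta ξ).comp (continuous_Theta' ξ))
      ((continuous_Theta' ξ).comp (continuous_Theta ξ))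
  · intro κ x
    change Theta ξ (Theta' ξ (spin ξ κ x)) = Theta' ξ (Theta ξ (spin ξ κ x))
    rw [Theta_spin, map_smul, Theta'_spin]
    split_ifs
    · rw [Theta_spin]
    · rw [map_smul, Theta_spin]

/-! ### Strings, ladder operators and their behaviour under the rotations -/

/-- All that is needed about `S_x` is stable under products, so it reduces to `σ_3` at a single site
and the order of the factors plays no role. -/
lemma multiplicator_induction {P : InfAlg ξ → Prop} (one : P 1)
    (mul : ∀ A B, P A → P B → P (A * B)) (spin3 : ∀ y, P (spin ξ 3 y)) (x : ℤ) :
    P (multiplicator ξ x) := by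
  have key : ∀ l : List ℤ, P (l.map (spin ξ 3)).prod := by
    intro l
    induction l with
    | nil => simpa using one
    | cons y l ih => simpa using mul _ _ (spin3 y) ih
  unfold multiplicator
  split_ifs <;> exact key _

lemma Theta_multiplicator (x : ℤ) : Theta ξ (multiplicator ξ x) = multiplicator ξ x :=
  multiplicator_induction ξ (P := fun A => Theta ξ A = A) (map_one _)
    (fun A B hA hB => by rw [map_mul, hA, hB])
    (fun y => by rw [Theta_spin]; simp [pauliSign]) x

lemma Theta'_multiplicator (x : ℤ) : Theta' ξ (multiplicator ξ x) = multiplicator ξ x :=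
  multiplicator_induction ξ (P := fun A => Theta' ξ A = A) (map_one _)
    (fun A B hA hB => by rw [map_mul, hA, hB])
    (fun y => by rw [Theta'_spin]; simp [pauliSign]) x

lemma star_spin_three_mul_self (x : ℤ) : star (spin ξ 3 x) * spin ξ 3 x = 1 := by
  rw [← siteHom_pauli, ← siteHom_star, star_pauli_three, ← map_mul, pauli_three_mul_self, map_one]

lemma star_multiplicator_mul_self (x : ℤ) :
    star (multiplicator ξ x) * multiplicator ξ x = 1 :=
  multiplicator_induction ξ (P := fun A => star A * A = 1) (by simp)
    (fun A B hA hB => by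
      rw [star_mul, mul_assoc, ← mul_assoc (star A), hA, one_mul, hB])
    (star_spin_three_mul_self ξ) x

/-- Through this matrix unit, the algebraic relations at one site become identities between `2 × 2`
matrices. -/
lemma lowering_eq (x : ℤ) : lowering ξ x = siteHom ξ x !![0, 0; 1, 0] := by
  rw [lowering, ← siteHom_pauli, ← siteHom_pauli, ← map_smul, ← map_sub, ← map_smul]
  congr 1
  ext i j
  fin_cases i <;> fin_cases j <;> simp [pauli]; norm_num

lemma star_lowering_eq (x : ℤ) : star (lowering ξ x) = siteHom ξ x !![0, 1; 0, 0] := by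
  rw [lowering_eq, ← siteHom_star]
  congr 1
  ext i j
  fin_cases i <;> fin_cases j <;> simp

lemma spin_zero (x : ℤ) : spin ξ 0 x = 1 := by
  rw [← siteHom_pauli]
  exact map_one _

lemma spin_one_eq (x : ℤ) : spin ξ 1 x = lowering ξ x + star (lowering ξ x) := by
  rw [star_lowering_eq, lowering_eq, ← map_add, ← siteHom_pauli]
  congr 1
  ext i j
  fin_cases i <;> fin_cases j <;> simp [pauli]

lemma spin_two_eq (x : ℤ) :
    spin ξ 2 x = Complex.I • (lowering ξ x - star (lowering ξ x)) := by
  rw [star_lowering_eq, lowering_eq, ← map_sub, ← map_smul, ← siteHom_pauli]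
  congr 1
  ext i j
  fin_cases i <;> fin_cases j <;> simp [pauli]

lemma spin_three_eq (x : ℤ) :
    spin ξ 3 x = (2 : ℂ) • (star (lowering ξ x) * lowering ξ x) - 1 := by
  rw [star_lowering_eq, lowering_eq, ← map_mul, ← map_smul, ← map_one (siteHom ξ x), ← map_sub,
    ← siteHom_pauli]
  congr 1
  ext i j
  fin_cases i <;> fin_cases j <;> simp [pauli]; norm_num

lemma lowering_anticomm (x : ℤ) :
    star (lowering ξ x) * lowering ξ x + lowering ξ x * star (lowering ξ x) = 1 := by
  rw [star_lowering_eq, lowering_eq, ← map_mul (siteHom ξ x), ← map_mul (siteHom ξ x),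
    ← map_add (siteHom ξ x), ← map_one (siteHom ξ x)]
  congr 1
  ext i j
  fin_cases i <;> fin_cases j <;> simp

lemma Theta_lowering (x : ℤ) : Theta ξ (lowering ξ x) = -lowering ξ x := by
  rw [lowering, map_smul, map_sub, map_smul, Theta_spin, Theta_spin]
  simp only [pauliSign]
  simp only [Matrix.cons_val]
  module

lemma Theta'_lowering (x : ℤ) :
    Theta' ξ (lowering ξ x) = if 1 ≤ x then lowering ξ x else -lowering ξ x := by
  rw [lowering, map_smul, map_sub, map_smul, Theta'_spin, Theta'_spin]
  simp only [pauliSign]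
  split_ifs
  · rfl
  · simp only [Matrix.cons_val]
    module

/-! ### Coordinates on the crossed product extension -/

/-- The element of `𝔄̂` with first row `(A, B)`. -/
def hatMk (A B : InfAlg ξ) : Hat ξ := ⟨hatMatrix ξ A B, A, B, rfl⟩

variable {ξ} in
/-- The upper left entry. -/
def hatFst (X : Hat ξ) : InfAlg ξ := X.1 0 0

variable {ξ} in
/-- The upper right entry. -/
def hatSnd (X : Hat ξ) : InfAlg ξ := X.1 0 1

@[simp] lemma hatFst_mk (A B : InfAlg ξ) : hatFst (hatMk ξ A B) = A := rfl

@[simp] lemma hatSnd_mk (A B : InfAlg ξ) : hatSnd (hatMk ξ A B) = B := rfl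

lemma exists_eq_hatMk (X : Hat ξ) : ∃ A B, X = hatMk ξ A B := by
  obtain ⟨X, A, B, rfl⟩ := X
  exact ⟨A, B, rfl⟩

lemma hatMk_fst_snd (X : Hat ξ) : hatMk ξ (hatFst X) (hatSnd X) = X := by
  obtain ⟨A, B, rfl⟩ := exists_eq_hatMk ξ X
  rfl

lemma hatMk_inj {A B C D : InfAlg ξ} : hatMk ξ A B = hatMk ξ C D ↔ A = C ∧ B = D :=
  ⟨fun h => ⟨congrArg hatFst h, congrArg hatSnd h⟩, by rintro ⟨rfl, rfl⟩; rfl⟩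

lemma hatMk_mul (A B C D : InfAlg ξ) : hatMk ξ A B * hatMk ξ C D
    = hatMk ξ (A * C + B * Theta' ξ D) (A * D + B * Theta' ξ C) :=
  Subtype.ext (hatMatrix_mul ξ A B C D)

lemma hatMk_add (A B C D : InfAlg ξ) :
    hatMk ξ A B + hatMk ξ C D = hatMk ξ (A + C) (B + D) :=
  Subtype.ext (hatMatrix_add ξ A B C D)

lemma hatMk_star (A B : InfAlg ξ) :
    star (hatMk ξ A B) = hatMk ξ (star A) (star (Theta' ξ B)) :=
  Subtype.ext (hatMatrix_star ξ A B)

lemma psi_eq (A : InfAlg ξ) : psi ξ A = hatMk ξ A 0 := rfl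

lemma anchor_eq : anchor ξ = hatMk ξ 0 1 := rfl

lemma hatMk_one : hatMk ξ 1 0 = 1 := map_one (psi ξ)

lemma hatMk_algebraMap (c : ℂ) : algebraMap ℂ (Hat ξ) c = hatMk ξ (algebraMap ℂ _ c) 0 :=
  Subtype.ext (hatMatrix_algebraMap ξ c).symm

lemma hatMk_smul (c : ℂ) (A B : InfAlg ξ) : c • hatMk ξ A B = hatMk ξ (c • A) (c • B) := by
  rw [Algebra.smul_def, hatMk_algebraMap, hatMk_mul]
  simp [Algebra.smul_def]

lemma hatMk_neg (A B : InfAlg ξ) : -hatMk ξ A B = hatMk ξ (-A) (-B) := by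
  rw [← neg_one_smul ℂ, hatMk_smul]
  simp

lemma hatMk_mul_anchor (A B : InfAlg ξ) : hatMk ξ A B * anchor ξ = hatMk ξ B A := by
  rw [anchor_eq, hatMk_mul]
  simp

lemma anchor_mul_hatMk (A B : InfAlg ξ) :
    anchor ξ * hatMk ξ A B = hatMk ξ (Theta' ξ B) (Theta' ξ A) := by
  rw [anchor_eq, hatMk_mul]
  simp

/-- Thus `T` and the image of `psi` generate the extension algebraically, and a homomorphism is
fixed by its values on them. -/
lemma hatMk_eq_psi (A B : InfAlg ξ) : hatMk ξ A B = psi ξ A + psi ξ B * anchor ξ := by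
  rw [psi_eq, psi_eq, hatMk_mul_anchor, hatMk_add]
  simp

lemma continuous_hatFst : Continuous (hatFst (ξ := ξ)) := by
  have h : Continuous fun X : CStarMatrix (Fin 2) (Fin 2) (InfAlg ξ) => X 0 0 :=
    (continuous_apply_apply (0 : Fin 2) (0 : Fin 2) :
      Continuous fun X : Fin 2 → Fin 2 → InfAlg ξ => X 0 0)
  exact h.comp continuous_subtype_val

lemma continuous_hatSnd : Continuous (hatSnd (ξ := ξ)) := by
  have h : Continuous fun X : CStarMatrix (Fin 2) (Fin 2) (InfAlg ξ) => X 0 1 :=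
    (continuous_apply_apply (0 : Fin 2) (1 : Fin 2) :
      Continuous fun X : Fin 2 → Fin 2 → InfAlg ξ => X 0 1)
  exact h.comp continuous_subtype_val

lemma continuous_hatMk : Continuous fun p : InfAlg ξ × InfAlg ξ => hatMk ξ p.1 p.2 := by
  refine Continuous.subtype_mk ?_ _
  -- The topology of `CStarMatrix` is definitionally that of entrywise convergence, so continuity
  -- can be tested on entries.
  change Continuous fun p : InfAlg ξ × InfAlg ξ =>
    (!![p.1, p.2; Theta' ξ p.2, Theta' ξ p.1] : Matrix (Fin 2) (Fin 2) (InfAlg ξ))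
  have h := continuous_Theta' ξ
  refine continuous_matrix fun i j => ?_
  fin_cases i <;> fin_cases j
  · exact continuous_fst
  · exact continuous_snd
  · exact h.comp continuous_snd
  · exact h.comp continuous_fst

/-! ### The rotation of the crossed product extension -/

/-- The spin rotation `Θ̂`, which acts by `Θ` on the entries. -/
def hatTheta : Hat ξ ≃⋆ₐ[ℂ] Hat ξ where
  toFun X := hatMk ξ (Theta ξ (hatFst X)) (Theta ξ (hatSnd X))
  invFun X := hatMk ξ (Theta ξ (hatFst X)) (Theta ξ (hatSnd X))
  left_inv X := by simp [Theta_Theta, hatMk_fst_snd]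
  right_inv X := by simp [Theta_Theta, hatMk_fst_snd]
  map_mul' X Y := by
    obtain ⟨A, B, rfl⟩ := exists_eq_hatMk ξ X
    obtain ⟨C, D, rfl⟩ := exists_eq_hatMk ξ Y
    -- The product formula applies `Θ'` to the second factor, which is why the two rotations have to
    -- commute.
    simp [hatMk_mul, Theta_Theta']
  map_add' X Y := by
    obtain ⟨A, B, rfl⟩ := exists_eq_hatMk ξ X
    obtain ⟨C, D, rfl⟩ := exists_eq_hatMk ξ Y
    simp [hatMk_add]
  map_star' X := by
    obtain ⟨A, B, rfl⟩ := exists_eq_hatMk ξ X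
    simp [hatMk_star, map_star, Theta_Theta']
  map_smul' c X := by
    obtain ⟨A, B, rfl⟩ := exists_eq_hatMk ξ X
    simp [hatMk_smul]

lemma hatTheta_mk (A B : InfAlg ξ) : hatTheta ξ (hatMk ξ A B) = hatMk ξ (Theta ξ A) (Theta ξ B) :=
  rfl

lemma hatTheta_psi (A : InfAlg ξ) : hatTheta ξ (psi ξ A) = psi ξ (Theta ξ A) := by
  rw [psi_eq, hatTheta_mk, map_zero, psi_eq]

lemma hatTheta_anchor : hatTheta ξ (anchor ξ) = anchor ξ := by
  rw [anchor_eq, hatTheta_mk, map_zero, map_one]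

lemma eq_hatTheta {θ : Hat ξ ≃⋆ₐ[ℂ] Hat ξ} (h : ∀ A, θ (psi ξ A) = psi ξ (Theta ξ A))
    (hT : θ (anchor ξ) = anchor ξ) : θ = hatTheta ξ := by
  refine StarAlgEquiv.ext fun X => ?_
  obtain ⟨A, B, rfl⟩ := exists_eq_hatMk ξ X
  rw [hatMk_eq_psi, map_add, map_mul, h, h, hT, map_add, map_mul, hatTheta_psi, hatTheta_psi,
    hatTheta_anchor]

lemma hatTheta_hatTheta (X : Hat ξ) : hatTheta ξ (hatTheta ξ X) = X := (hatTheta ξ).left_inv X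

lemma continuous_hatTheta : Continuous (hatTheta ξ) :=
  (continuous_hatMk ξ).comp (((continuous_Theta ξ).comp (continuous_hatFst ξ)).prodMk
    ((continuous_Theta ξ).comp (continuous_hatSnd ξ)))

/-! ### Even and odd parts of invariant subalgebras -/

section Grading

variable {ξ} {θ : Hat ξ ≃⋆ₐ[ℂ] Hat ξ} (C : StarSubalgebra ℂ (Hat ξ))

lemma isClosed_evenPart (hc : Continuous θ) {C : Set (Hat ξ)} (hC : IsClosed C) :
    IsClosed (evenPart θ C) :=
  hC.inter (isClosed_eq hc continuous_id)

lemma isClosed_oddPart (hc : Continuous θ) {C : Set (Hat ξ)} (hC : IsClosed C) :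
    IsClosed (oddPart θ C) :=
  hC.inter (isClosed_eq hc continuous_neg)

variable (θ) in
/-- The even part of a star subalgebra, as a star subalgebra. -/
def evenSubalgebra : StarSubalgebra ℂ (Hat ξ) where
  carrier := evenPart θ (C : Set (Hat ξ))
  mul_mem' := fun ⟨hA, hA'⟩ ⟨hB, hB'⟩ => ⟨mul_mem hA hB, by rw [map_mul, hA', hB']⟩
  add_mem' := fun ⟨hA, hA'⟩ ⟨hB, hB'⟩ => ⟨add_mem hA hB, by rw [map_add, hA', hB']⟩
  algebraMap_mem' c := ⟨C.algebraMap_mem c, by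
    rw [Algebra.algebraMap_eq_smul_one, map_smul, map_one]⟩
  star_mem' := fun ⟨hA, hA'⟩ => ⟨star_mem hA, by rw [map_star, hA']⟩

variable (θ) in
/-- The odd part of a star subalgebra, as a vector subspace. -/
def oddSubmodule : Submodule ℂ (Hat ξ) where
  carrier := oddPart θ (C : Set (Hat ξ))
  add_mem' := fun ⟨hA, hA'⟩ ⟨hB, hB'⟩ => ⟨add_mem hA hB, by rw [map_add, hA', hB', neg_add]⟩
  zero_mem' := ⟨zero_mem C, by rw [map_zero, neg_zero]⟩
  smul_mem' := fun c _ ⟨hA, hA'⟩ => ⟨C.smul_mem hA c, by rw [map_smul, hA', smul_neg]⟩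

lemma isUnitalCStarSubalgebra_evenPart (hc : Continuous θ) (hC : IsClosed (C : Set (Hat ξ))) :
    IsUnitalCStarSubalgebra (evenPart θ (C : Set (Hat ξ))) :=
  ⟨isClosed_evenPart hc hC, evenSubalgebra θ C, rfl⟩

lemma isClosedStarSubspace_oddPart (hc : Continuous θ) (hC : IsClosed (C : Set (Hat ξ))) :
    IsClosedStarSubspace (oddPart θ (C : Set (Hat ξ))) :=
  ⟨isClosed_oddPart hc hC, ⟨oddSubmodule θ C, rfl⟩,
    fun _ ⟨hA, hA'⟩ => ⟨star_mem hA, by rw [map_star, hA', star_neg]⟩⟩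

/-- The projections `(1 ± θ) / 2` of the involution map the invariant subalgebra `C` to itself; an
element in both parts equals its own negative. -/
lemma isDirectSum_evenPart_oddPart (hθ : ∀ X, θ (θ X) = X) (hCθ : ∀ X ∈ C, θ X ∈ C) :
    IsDirectSum (C : Set (Hat ξ))
    (evenPart θ (C : Set (Hat ξ))) (oddPart θ (C : Set (Hat ξ))) := by
  refine ⟨Subalgebra.toSubmodule (evenSubalgebra θ C).toSubalgebra, oddSubmodule θ C, rfl, rfl,
    ?_, ?_⟩
  · ext X
    rw [SetLike.mem_coe, Submodule.mem_sup]
    constructor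
    · rintro ⟨A, hA, B, hB, rfl⟩
      exact add_mem hA.1 hB.1
    · intro hX
      refine ⟨(1 / 2 : ℂ) • (X + θ X), ⟨C.smul_mem (add_mem hX (hCθ X hX)) _, ?_⟩,
        (1 / 2 : ℂ) • (X - θ X), ⟨C.smul_mem (sub_mem hX (hCθ X hX)) _, ?_⟩, ?_⟩
      · rw [map_smul, map_add, hθ, add_comm]
      · rw [map_smul, map_sub, hθ, ← smul_neg, neg_sub]
      · module
  · rw [Submodule.disjoint_def]
    intro X hX hX'
    have h : X = -X := hX.2.symm.trans hX'.2
    have h2 : (2 : ℂ) • X = 0 := by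
      rw [two_smul]
      exact eq_neg_iff_add_eq_zero.1 h
    exact (smul_eq_zero.1 h2).resolve_left two_ne_zero

end Grading

/-! ### The CAR subalgebra -/

/-- The CAR subalgebra, as a non-unital star subalgebra. -/
def carSub : NonUnitalStarSubalgebra ℂ (Hat ξ) :=
  sInf {B | IsClosed (B : Set (Hat ξ)) ∧ Set.range (annihilation ξ) ⊆ B}

lemma coe_carSub : (carSub ξ : Set (Hat ξ)) = Hat1 ξ := NonUnitalStarAlgebra.coe_sInf _

lemma isClosed_carSub : IsClosed (carSub ξ : Set (Hat ξ)) := by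
  rw [coe_carSub]
  exact isClosed_biInter fun B hB => hB.1

lemma annihilation_mem (x : ℤ) : annihilation ξ x ∈ carSub ξ :=
  NonUnitalStarAlgebra.mem_sInf.2 fun _ hB => hB.2 ⟨x, rfl⟩

lemma carSub_le {B : NonUnitalStarSubalgebra ℂ (Hat ξ)} (hB : IsClosed (B : Set (Hat ξ)))
    (h : ∀ x, annihilation ξ x ∈ B) : carSub ξ ≤ B :=
  sInf_le ⟨hB, by rintro _ ⟨x, rfl⟩; exact h x⟩

/-- Moving `T` past `psi` applies `Θ'`, and this leaves `S_x` fixed. -/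
lemma annihilation_eq (x : ℤ) :
    annihilation ξ x = hatMk ξ 0 (multiplicator ξ x * Theta' ξ (lowering ξ x)) := by
  rw [annihilation, psi_eq, anchor_mul_hatMk, map_zero, map_mul, Theta'_multiplicator]

/-- The elements of `𝔄̂` with even diagonal and odd off-diagonal entries. -/
def twistedEven : StarSubalgebra ℂ (Hat ξ) where
  carrier := {X | Theta ξ (hatFst X) = hatFst X ∧ Theta ξ (hatSnd X) = -hatSnd X}
  -- Diagonal and off-diagonal entries multiply like even and odd elements; the `Θ'` in the product
  -- formula does not disturb parity.
  mul_mem' := by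
    rintro X Y ⟨h₁, h₂⟩ ⟨h₃, h₄⟩
    obtain ⟨A, B, rfl⟩ := exists_eq_hatMk ξ X
    obtain ⟨C, D, rfl⟩ := exists_eq_hatMk ξ Y
    simp only [hatFst_mk, hatSnd_mk] at h₁ h₂ h₃ h₄
    simp [hatMk_mul, Theta_Theta', h₁, h₂, h₃, h₄, add_comm]
  add_mem' := by
    rintro X Y ⟨h₁, h₂⟩ ⟨h₃, h₄⟩
    obtain ⟨A, B, rfl⟩ := exists_eq_hatMk ξ X
    obtain ⟨C, D, rfl⟩ := exists_eq_hatMk ξ Y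
    simp only [hatFst_mk, hatSnd_mk] at h₁ h₂ h₃ h₄
    simp [hatMk_add, h₁, h₂, h₃, h₄, add_comm]
  algebraMap_mem' c := by
    rw [hatMk_algebraMap]
    simp [Algebra.algebraMap_eq_smul_one]
  star_mem' := by
    rintro X ⟨h₁, h₂⟩
    obtain ⟨A, B, rfl⟩ := exists_eq_hatMk ξ X
    simp only [hatFst_mk, hatSnd_mk] at h₁ h₂
    simp [hatMk_star, Theta_Theta', map_star, h₁, h₂]

lemma hatMk_mem_twistedEven {A B : InfAlg ξ} :
    hatMk ξ A B ∈ twistedEven ξ ↔ Theta ξ A = A ∧ Theta ξ B = -B := Iff.rfl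

lemma isClosed_twistedEven : IsClosed (twistedEven ξ : Set (Hat ξ)) := by
  have h₁ := continuous_hatFst ξ
  have h₂ := continuous_hatSnd ξ
  exact (isClosed_eq ((continuous_Theta ξ).comp h₁) h₁).inter
    (isClosed_eq ((continuous_Theta ξ).comp h₂) h₂.neg)

/-- By minimality only `a_x` has to be checked: its diagonal vanishes and its off-diagonal entry is
odd, as `S_x` is even and `σ_-` is odd. -/
lemma carSub_subset_twistedEven {X : Hat ξ} (hX : X ∈ carSub ξ) : X ∈ twistedEven ξ := by
  refine carSub_le ξ (B := (twistedEven ξ).toNonUnitalStarSubalgebra) (isClosed_twistedEven ξ)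
    (fun x => ?_) hX
  change _ ∈ twistedEven ξ
  rw [annihilation_eq, hatMk_mem_twistedEven]
  refine ⟨map_zero _, ?_⟩
  rw [map_mul, Theta_multiplicator, Theta_Theta', Theta_lowering, map_neg, mul_neg]

/-- The subalgebras in the definition of `Hat1` need not be unital, so the unit must be produced. At
`x = 1` the string is empty and `Θ'` acts trivially, which makes the anticommutator of `a_1` and its
adjoint a pure one-site computation. -/
lemma one_mem_carSub : 1 ∈ carSub ξ := by
  have h := annihilation_mem ξ 1
  have h' := add_mem (mul_mem (star_mem h) h) (mul_mem h (star_mem h))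
  have hS : multiplicator ξ 1 = 1 := by simp [multiplicator, Int.range]
  rw [annihilation_eq, hS, Theta'_lowering, if_pos le_rfl, one_mul, hatMk_star, Theta'_lowering,
    if_pos le_rfl, star_zero, hatMk_mul, hatMk_mul, hatMk_add, Theta'_lowering, if_pos le_rfl,
    map_star, Theta'_lowering, if_pos le_rfl] at h'
  simpa [lowering_anticomm, hatMk_one] using h'

/-! ### Inverting the Jordan–Wigner transformation -/

/-- The star endomorphism of `𝔄̂` which acts by `Θ'` on the entries, i.e. conjugation by the
anchor element. -/
def anchorConj : Hat ξ →⋆ₙₐ[ℂ] Hat ξ where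
  toFun X := hatMk ξ (Theta' ξ (hatFst X)) (Theta' ξ (hatSnd X))
  map_mul' X Y := by
    obtain ⟨A, B, rfl⟩ := exists_eq_hatMk ξ X
    obtain ⟨C, D, rfl⟩ := exists_eq_hatMk ξ Y
    simp [hatMk_mul]
  map_zero' := by
    rw [← map_zero (psi ξ), psi_eq]
    simp
  map_add' X Y := by
    obtain ⟨A, B, rfl⟩ := exists_eq_hatMk ξ X
    obtain ⟨C, D, rfl⟩ := exists_eq_hatMk ξ Y
    simp [hatMk_add]
  map_star' X := by
    obtain ⟨A, B, rfl⟩ := exists_eq_hatMk ξ X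
    simp [hatMk_star, map_star]
  map_smul' c X := by
    obtain ⟨A, B, rfl⟩ := exists_eq_hatMk ξ X
    simp [hatMk_smul]

lemma anchorConj_mk (A B : InfAlg ξ) :
    anchorConj ξ (hatMk ξ A B) = hatMk ξ (Theta' ξ A) (Theta' ξ B) := rfl

lemma continuous_anchorConj : Continuous (anchorConj ξ) :=
  (continuous_hatMk ξ).comp (((continuous_Theta' ξ).comp (continuous_hatFst ξ)).prodMk
    ((continuous_Theta' ξ).comp (continuous_hatSnd ξ)))

/-- The CAR subalgebra is invariant under conjugation by the anchor element. -/
lemma hatMk_Theta'_mem {A B : InfAlg ξ} (h : hatMk ξ A B ∈ carSub ξ) :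
    hatMk ξ (Theta' ξ A) (Theta' ξ B) ∈ carSub ξ := by
  -- The preimage under the conjugation is again a closed star subalgebra, so it suffices that the
  -- conjugation sends `a_x` to `a_x` for `x ≥ 1` and to `-a_x` for `x ≤ 0`.
  have hle : carSub ξ ≤ (carSub ξ).comap (anchorConj ξ) := by
    refine carSub_le ξ ((isClosed_carSub ξ).preimage (continuous_anchorConj ξ)) fun x => ?_
    have hx := annihilation_mem ξ x
    rw [NonUnitalStarSubalgebra.mem_comap]
    rw [annihilation_eq] at hx ⊢
    rw [anchorConj_mk, map_mul, map_zero, Theta'_multiplicator, Theta'_Theta']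
    rw [Theta'_lowering] at hx
    split_ifs at hx
    · exact hx
    · have hn := neg_mem hx
      rwa [mul_neg, hatMk_neg, neg_zero, neg_neg] at hn
  exact hle h

lemma multiplicator_mul_lowering_mem (x : ℤ) :
    hatMk ξ 0 (multiplicator ξ x * lowering ξ x) ∈ carSub ξ := by
  have h := annihilation_mem ξ x
  rw [annihilation_eq] at h
  simpa [Theta'_multiplicator, Theta'_Theta'] using hatMk_Theta'_mem ξ h

/-- In the product of the adjoint of `a_x` with `a_x` both `T` and the string cancel, leaving `psi
(σ_+ σ_-)`; moreover `σ_3 = 2 σ_+ σ_- - 1`. -/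
lemma psi_spin_three_mem (x : ℤ) : psi ξ (spin ξ 3 x) ∈ carSub ξ := by
  have h := annihilation_mem ξ x
  have h' := mul_mem (star_mem h) h
  rw [annihilation_eq, hatMk_star, hatMk_mul, map_mul, Theta'_multiplicator,
    Theta'_Theta', star_mul, mul_assoc, ← mul_assoc (star (multiplicator ξ x)),
    star_multiplicator_mul_self, one_mul] at h'
  have h'' : psi ξ (star (lowering ξ x) * lowering ξ x) ∈ carSub ξ := by
    rw [psi_eq]
    simpa using h'
  rw [spin_three_eq, map_sub, map_smul, map_one]
  exact sub_mem (SMulMemClass.smul_mem _ h'') (one_mem_carSub ξ)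

lemma psi_multiplicator_mem (x : ℤ) : psi ξ (multiplicator ξ x) ∈ carSub ξ :=
  multiplicator_induction ξ (P := fun A => psi ξ A ∈ carSub ξ)
    (by rw [map_one]; exact one_mem_carSub ξ)
    (fun A B hA hB => by rw [map_mul]; exact mul_mem hA hB) (psi_spin_three_mem ξ) x

/-- With every `σ_3`, and hence `S_x`, available on the diagonal, the string is removed by its
adjoint. -/
lemma lowering_mem (x : ℤ) : hatMk ξ 0 (lowering ξ x) ∈ carSub ξ := by
  have h := mul_mem (star_mem (psi_multiplicator_mem ξ x)) (multiplicator_mul_lowering_mem ξ x)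
  rw [← map_star, psi_eq, hatMk_mul, ← mul_assoc, star_multiplicator_mul_self] at h
  simpa using h

/-- Taking adjoints of an off-diagonal element inserts `Θ'`, which the prior conjugation by `T`
undoes. -/
lemma star_lowering_mem (x : ℤ) : hatMk ξ 0 (star (lowering ξ x)) ∈ carSub ξ := by
  have h := star_mem (hatMk_Theta'_mem ξ (lowering_mem ξ x))
  simpa [hatMk_star, Theta'_Theta'] using h

/-- The elements of `𝔄` whose even part and whose odd part, multiplied by the anchor element,
belong to the CAR subalgebra. -/
def carPreimage : Subalgebra ℂ (InfAlg ξ) where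
  carrier := {A | hatMk ξ (A + Theta ξ A) 0 ∈ carSub ξ ∧ hatMk ξ 0 (A - Theta ξ A) ∈ carSub ξ}
  mul_mem' := by
    rintro A B ⟨h₁, h₂⟩ ⟨h₃, h₄⟩
    -- With `A± = A ± Θ A`, one has `2 (AB)₊ = A₊ B₊ + A₋ B₋` and `2 (AB)₋ = A₊ B₋ + A₋ B₊`. An
    -- off-diagonal left factor applies `Θ'` to the right one, so the right factor is replaced
    -- beforehand by its image under `Θ'`.
    have hB : hatMk ξ 0 (Theta' ξ (B - Theta ξ B)) ∈ carSub ξ := by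
      simpa using hatMk_Theta'_mem ξ h₄
    constructor
    · have h := SMulMemClass.smul_mem (1 / 2 : ℂ) (add_mem (mul_mem h₁ h₃) (mul_mem h₂ hB))
      rw [hatMk_mul, hatMk_mul, hatMk_add, hatMk_smul, Theta'_Theta'] at h
      convert h using 2
      · simp only [map_zero, mul_zero, add_zero, zero_add, map_mul, mul_add, add_mul, mul_sub,
          sub_mul]
        module
      · simp
    · have h := SMulMemClass.smul_mem (1 / 2 : ℂ)
        (add_mem (mul_mem h₁ h₄) (mul_mem h₂ (hatMk_Theta'_mem ξ h₃)))
      simp only [hatMk_mul, hatMk_add, hatMk_smul, Theta'_Theta'] at h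
      convert h using 2
      · simp
      · simp only [map_zero, mul_zero, add_zero, zero_add, map_mul, mul_add, add_mul, mul_sub,
          sub_mul]
        module
  add_mem' := by
    rintro A B ⟨h₁, h₂⟩ ⟨h₃, h₄⟩
    constructor
    · have h := add_mem h₁ h₃
      rw [hatMk_add, add_zero, add_add_add_comm, ← map_add] at h
      exact h
    · have h := add_mem h₂ h₄
      rw [hatMk_add, add_zero, sub_add_sub_comm, ← map_add] at h
      exact h
  algebraMap_mem' c := by
    -- The carrier uses `A + Θ A` without the factor one half, so a scalar `c` contributes `2 c`.
    have h := SMulMemClass.smul_mem (2 * c) (one_mem_carSub ξ)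
    rw [← hatMk_one, hatMk_smul] at h
    simp only [Algebra.algebraMap_eq_smul_one, Set.mem_ofPred_eq, map_smul, map_one, sub_self]
    refine ⟨?_, ?_⟩
    · convert h using 2
      · module
      · simp
    · convert zero_mem (carSub ξ)
      rw [← map_zero (psi ξ), psi_eq]

lemma isClosed_carPreimage : IsClosed (carPreimage ξ : Set (InfAlg ξ)) := by
  have h := continuous_Theta ξ
  have hm := continuous_hatMk ξ
  refine IsClosed.inter
    ((isClosed_carSub ξ).preimage (f := fun A => hatMk ξ (A + Theta ξ A) 0) ?_)
    ((isClosed_carSub ξ).preimage (f := fun A => hatMk ξ 0 (A - Theta ξ A)) ?_)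
  · exact hm.comp ((continuous_id.add h).prodMk continuous_const)
  · exact hm.comp (continuous_const.prodMk (continuous_id.sub h))

lemma mem_carPreimage_of_odd {A : InfAlg ξ} (hA : Theta ξ A = -A) (h : hatMk ξ 0 A ∈ carSub ξ) :
    A ∈ carPreimage ξ := by
  have h2 := add_mem h h
  rw [hatMk_add, add_zero] at h2
  refine ⟨?_, by rwa [hA, sub_neg_eq_add]⟩
  rw [hA, add_neg_cancel, ← psi_eq, map_zero]
  exact zero_mem _

/-- Both ladder operators are odd and lie, times `T`, in the CAR subalgebra; the spin observables
are polynomials in them. -/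
lemma mem_carPreimage (A : InfAlg ξ) : A ∈ carPreimage ξ := by
  have hm : ∀ x, lowering ξ x ∈ carPreimage ξ := fun x =>
    mem_carPreimage_of_odd ξ (Theta_lowering ξ x) (lowering_mem ξ x)
  have hp : ∀ x, star (lowering ξ x) ∈ carPreimage ξ := fun x =>
    mem_carPreimage_of_odd ξ (by rw [map_star, Theta_lowering, star_neg]) (star_lowering_mem ξ x)
  refine mem_of_spin_mem ξ _ (isClosed_carPreimage ξ) (fun κ x => ?_) A
  fin_cases κ
  · change spin ξ 0 x ∈ _
    rw [spin_zero]
    exact one_mem _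
  · change spin ξ 1 x ∈ _
    rw [spin_one_eq]
    exact add_mem (hm x) (hp x)
  · change spin ξ 2 x ∈ _
    rw [spin_two_eq]
    exact Subalgebra.smul_mem _ (sub_mem (hm x) (hp x)) _
  · change spin ξ 3 x ∈ _
    rw [spin_three_eq]
    exact sub_mem (Subalgebra.smul_mem _ (mul_mem (hp x) (hm x)) _) (one_mem _)

/-- The CAR subalgebra consists of the elements of `𝔄̂` with even diagonal and odd off-diagonal
entries. -/
theorem Hat1_eq : Hat1 ξ = twistedEven ξ := by
  rw [← coe_carSub]
  refine Set.Subset.antisymm (fun X hX => carSub_subset_twistedEven ξ hX) fun X hX => ?_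
  obtain ⟨A, B, rfl⟩ := exists_eq_hatMk ξ X
  obtain ⟨hA, hB⟩ := (hatMk_mem_twistedEven ξ).1 hX
  -- For `A` even and `B` odd, `A + Θ A = 2 A` and `B - Θ B = 2 B`.
  have h := SMulMemClass.smul_mem (1 / 2 : ℂ)
    (add_mem (mem_carPreimage ξ A).1 (mem_carPreimage ξ B).2)
  rw [hA, hB, hatMk_add, hatMk_smul] at h
  change hatMk ξ A B ∈ carSub ξ
  convert h using 2 <;> module

/-! ### The decomposition -/

lemma hatMk_mem_Hat0 {A B : InfAlg ξ} : hatMk ξ A B ∈ Hat0 ξ ↔ B = 0 := by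
  constructor
  · rintro ⟨C, hC⟩
    exact ((hatMk_inj ξ).1 hC).2.symm
  · rintro rfl
    exact ⟨A, rfl⟩

lemma isClosed_Hat0 : IsClosed (Hat0 ξ) := by
  have : Hat0 ξ = {X | hatSnd X = 0} := by
    ext X
    obtain ⟨A, B, rfl⟩ := exists_eq_hatMk ξ X
    exact hatMk_mem_Hat0 ξ
  rw [this]
  exact isClosed_eq (continuous_hatSnd ξ) continuous_const

lemma hatTheta_mem_Hat0 {X : Hat ξ} (hX : X ∈ Hat0 ξ) : hatTheta ξ X ∈ Hat0 ξ := by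
  obtain ⟨A, rfl⟩ := hX
  exact ⟨Theta ξ A, (hatTheta_psi ξ A).symm⟩

lemma hatTheta_mem_twistedEven {X : Hat ξ} (hX : X ∈ twistedEven ξ) :
    hatTheta ξ X ∈ twistedEven ξ := by
  obtain ⟨A, B, rfl⟩ := exists_eq_hatMk ξ X
  obtain ⟨hA, hB⟩ := (hatMk_mem_twistedEven ξ).1 hX
  rw [hatTheta_mk, hatMk_mem_twistedEven]
  exact ⟨by rw [hA, hA], by rw [hB, map_neg, hB]⟩

lemma eq_neg_self_iff_eq_zero (B : InfAlg ξ) : B = -B ↔ B = 0 := by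
  rw [eq_neg_iff_add_eq_zero, ← two_smul ℂ, smul_eq_zero]
  simp

/-- On the CAR subalgebra the off-diagonal entry is odd; if it is also even, it vanishes and the
element is diagonal. -/
lemma evenPart_Hat1 : evenPart (hatTheta ξ) (Hat1 ξ) = evenPart (hatTheta ξ) (Hat0 ξ) := by
  ext X
  obtain ⟨A, B, rfl⟩ := exists_eq_hatMk ξ X
  change hatMk ξ A B ∈ Hat1 ξ ∧ hatTheta ξ _ = _ ↔ hatMk ξ A B ∈ Hat0 ξ ∧ hatTheta ξ _ = _
  rw [Hat1_eq, SetLike.mem_coe, hatMk_mem_twistedEven, hatTheta_mk, hatMk_inj, hatMk_mem_Hat0]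
  constructor
  · rintro ⟨⟨-, h₁⟩, h₂, h₃⟩
    exact ⟨(eq_neg_self_iff_eq_zero ξ B).1 (h₃.symm.trans h₁), h₂, h₃⟩
  · rintro ⟨rfl, h₂, h₃⟩
    exact ⟨⟨h₂, by simp⟩, h₂, h₃⟩

/-- Here the diagonal entry is both even and odd, so only an odd off-diagonal entry survives, and
`T` moves it to the diagonal. -/
lemma oddPart_Hat1 :
    oddPart (hatTheta ξ) (Hat1 ξ) = mulAnchor (oddPart (hatTheta ξ) (Hat0 ξ)) := by
  ext X
  obtain ⟨A, B, rfl⟩ := exists_eq_hatMk ξ X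
  change hatMk ξ A B ∈ Hat1 ξ ∧ hatTheta ξ _ = _ ↔ _
  rw [Hat1_eq, SetLike.mem_coe, hatMk_mem_twistedEven, hatTheta_mk, hatMk_neg, hatMk_inj]
  constructor
  · rintro ⟨⟨h₁, h₂⟩, h₃, -⟩
    obtain rfl := (eq_neg_self_iff_eq_zero ξ A).1 (h₁.symm.trans h₃)
    refine ⟨hatMk ξ B 0, ⟨(hatMk_mem_Hat0 ξ).2 rfl, ?_⟩, hatMk_mul_anchor ξ B 0⟩
    rw [hatTheta_mk, h₂, hatMk_neg, map_zero, neg_zero]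
  · rintro ⟨_, ⟨⟨C, rfl⟩, h⟩, hX⟩
    rw [psi_eq, hatTheta_mk, hatMk_neg, hatMk_inj] at h
    simp only [psi_eq] at hX
    rw [hatMk_mul_anchor, hatMk_inj] at hX
    obtain ⟨rfl, rfl⟩ := hX
    exact ⟨⟨map_zero _, h.1⟩, by simp, h.1⟩

/-- Multiplication by `T` swaps the entries, so the second summand has odd diagonal and even
off-diagonal entries. The sum is the parity decomposition of each entry. -/
lemma isDirectSum_Hat1_mulAnchor : IsDirectSum Set.univ (Hat1 ξ) (mulAnchor (Hat1 ξ)) := by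
  let V : Submodule ℂ (Hat ξ) := Subalgebra.toSubmodule (twistedEven ξ).toSubalgebra
  refine ⟨V, V.map (LinearMap.mulRight ℂ (anchor ξ)), (Hat1_eq ξ).symm, ?_, ?_, ?_⟩
  · rw [Hat1_eq]
    rfl
  · refine Set.eq_univ_of_forall fun X => ?_
    obtain ⟨A, B, rfl⟩ := exists_eq_hatMk ξ X
    refine Submodule.mem_sup.2 ⟨hatMk ξ ((1 / 2 : ℂ) • (A + Theta ξ A))
      ((1 / 2 : ℂ) • (B - Theta ξ B)), ?_, _, ⟨hatMk ξ ((1 / 2 : ℂ) • (B + Theta ξ B))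
      ((1 / 2 : ℂ) • (A - Theta ξ A)), ?_, rfl⟩, ?_⟩
    · refine (hatMk_mem_twistedEven ξ).2 ⟨?_, ?_⟩
      · rw [map_smul, map_add, Theta_Theta, add_comm]
      · rw [map_smul, map_sub, Theta_Theta, ← smul_neg, neg_sub]
    · refine (hatMk_mem_twistedEven ξ).2 ⟨?_, ?_⟩
      · rw [map_smul, map_add, Theta_Theta, add_comm]
      · rw [map_smul, map_sub, Theta_Theta, ← smul_neg, neg_sub]
    · rw [LinearMap.mulRight_apply, hatMk_mul_anchor, hatMk_add, hatMk_inj]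
      constructor <;> module
  · rw [Submodule.disjoint_def]
    rintro X hX ⟨Y, hY, hYX⟩
    obtain ⟨A, B, rfl⟩ := exists_eq_hatMk ξ Y
    rw [LinearMap.mulRight_apply, hatMk_mul_anchor] at hYX
    subst hYX
    obtain ⟨h₁, h₂⟩ := (hatMk_mem_twistedEven ξ).1 hX
    obtain ⟨h₃, h₄⟩ := (hatMk_mem_twistedEven ξ).1 hY
    obtain rfl := (eq_neg_self_iff_eq_zero ξ A).1 (h₃.symm.trans h₂)
    obtain rfl := (eq_neg_self_iff_eq_zero ξ B).1 (h₁.symm.trans h₄)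
    rw [← psi_eq, map_zero]

end ArakiJW

end


/-! ### The decomposition proposition -/

theorem mainTheorem3 {𝔄 : ℤ → Type*} [∀ x, CStarAlgebra (𝔄 x)]
    (ξ : ∀ x, 𝔄 x ≃⋆ₐ[ℂ] Matrix (Fin 2) (Fin 2) ℂ) :
    (∃! θ : Hat ξ ≃⋆ₐ[ℂ] Hat ξ,
      (∀ A, θ (psi ξ A) = psi ξ (Theta ξ A)) ∧ θ (anchor ξ) = anchor ξ) ∧
    ∀ θ : Hat ξ ≃⋆ₐ[ℂ] Hat ξ,
      (∀ A, θ (psi ξ A) = psi ξ (Theta ξ A)) → θ (anchor ξ) = anchor ξ →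
        (θ '' Hat0 ξ ⊆ Hat0 ξ ∧ θ '' Hat1 ξ ⊆ Hat1 ξ) ∧
        (IsUnitalCStarSubalgebra (evenPart θ Set.univ) ∧
          IsUnitalCStarSubalgebra (evenPart θ (Hat0 ξ)) ∧
          IsUnitalCStarSubalgebra (evenPart θ (Hat1 ξ))) ∧
        (IsClosedStarSubspace (oddPart θ Set.univ) ∧
          IsClosedStarSubspace (oddPart θ (Hat0 ξ)) ∧
          IsClosedStarSubspace (oddPart θ (Hat1 ξ))) ∧
        (IsDirectSum Set.univ (evenPart θ Set.univ) (oddPart θ Set.univ) ∧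
          IsDirectSum (Hat0 ξ) (evenPart θ (Hat0 ξ)) (oddPart θ (Hat0 ξ)) ∧
          IsDirectSum (Hat1 ξ) (evenPart θ (Hat1 ξ)) (oddPart θ (Hat1 ξ))) ∧
        evenPart θ (Hat1 ξ) = evenPart θ (Hat0 ξ) ∧
        oddPart θ (Hat1 ξ) = mulAnchor (oddPart θ (Hat0 ξ)) ∧
        IsDirectSum Set.univ (Hat1 ξ) (mulAnchor (Hat1 ξ)) := by
  refine ⟨⟨hatTheta ξ, ⟨hatTheta_psi ξ, hatTheta_anchor ξ⟩, fun θ h => eq_hatTheta ξ h.1 h.2⟩, ?_⟩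
  intro θ hψ hT
  obtain rfl := eq_hatTheta ξ hψ hT
  have hc := continuous_hatTheta ξ
  have hθ := hatTheta_hatTheta ξ
  -- The grading lemmas apply to closed invariant star subalgebras: `(psi ξ).range` for the spin
  -- part, `twistedEven ξ` for the CAR part and `⊤` for the whole.
  have hC0 : IsClosed ((psi ξ).range : Set (Hat ξ)) := isClosed_Hat0 ξ
  have hC1 := isClosed_twistedEven ξ
  have hU : ((⊤ : StarSubalgebra ℂ (Hat ξ)) : Set (Hat ξ)) = Set.univ := rfl
  have hCU : IsClosed ((⊤ : StarSubalgebra ℂ (Hat ξ)) : Set (Hat ξ)) := isClosed_univ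
  refine ⟨⟨?_, ?_⟩, ⟨?_, ?_, ?_⟩, ⟨?_, ?_, ?_⟩, ⟨?_, ?_, ?_⟩, evenPart_Hat1 ξ, oddPart_Hat1 ξ,
    isDirectSum_Hat1_mulAnchor ξ⟩
  · rintro _ ⟨X, hX, rfl⟩
    exact hatTheta_mem_Hat0 ξ hX
  · rw [Hat1_eq]
    rintro _ ⟨X, hX, rfl⟩
    exact hatTheta_mem_twistedEven ξ hX
  · rw [← hU]
    exact isUnitalCStarSubalgebra_evenPart _ hc hCU
  · exact isUnitalCStarSubalgebra_evenPart _ hc hC0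
  · rw [Hat1_eq]
    exact isUnitalCStarSubalgebra_evenPart _ hc hC1
  · rw [← hU]
    exact isClosedStarSubspace_oddPart _ hc hCU
  · exact isClosedStarSubspace_oddPart _ hc hC0
  · rw [Hat1_eq]
    exact isClosedStarSubspace_oddPart _ hc hC1
  · rw [← hU]
    exact isDirectSum_evenPart_oddPart _ hθ fun _ _ => trivial
  · exact isDirectSum_evenPart_oddPart (psi ξ).range hθ fun X hX => hatTheta_mem_Hat0 ξ hX
  · rw [Hat1_eq]
    exact isDirectSum_evenPart_oddPart _ hθ fun X hX => hatTheta_mem_twistedEven ξ hX
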